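/- Let $G=(V,E)$, $V=\{1,\dots,p\}$, be a directed acyclic graph and let $\breve{\mathbf x}(k)\in\mathbb R^p$, $k\in\mathbb Z$, be the state of the linear dynamical system $$\breve x_i(k)=\sum_{(j,i)\in E}(\breve h_{ij}\star\breve x_j)(k)+\breve e_i(k),\qquad 1\le i\le p,\ k\in\mathbb Z,$$ with nonzero absolutely summable real filters $\breve h_{ij}$ (for $(j,i)\in E$), where $\breve{\mathbf e}$ is a zero mean, wide-sense stationary, jointly Gaussian process, uncorrelated across nodes, with summable auto-correlation and power spectral density matrix $\Phi_{\mathbf e}(\omega)=\sigma(\omega)\mathbf I$. Let $R_{\mathbf x}(k)=\mathbb E[\breve{\mathbf x}(k)\breve{\mathbf x}(0)^T]$ and $\Phi_{\mathbf x}(\omega)=\sum_{k\in\mathbb Z}R_{\mathbf x}(k)e^{-i\omega k}$, and suppose that for some $M>0$ $$\tfrac1M\le\lambda_{\min}(\Phi_{\mathbf x}(\omega))\le\lambda_{\max}(\Phi_{\mathbf x}(\omega))\le M\qquad\text{for all }\omega\in[0,2\pi].$$ Let $n,N\ge1$ and let $\{\breve{\mathbf x}^r(k)\}_{k=0}^{N-1}$,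 $1\le r\le n$, be trajectories obtained in one of the following two ways: (i) restart and record: the $n$ trajectories are independent, each distributed as $(\breve{\mathbf x}(0),\dots,\breve{\mathbf x}(N-1))$; (ii) continuous sampling: $\breve{\mathbf x}^r(k)=\breve{\mathbf x}((r-1)N+k)$, i.e. consecutive segments of a single trajectory. Put $$\mathbf x^r(\omega)=\frac1{\sqrt N}\sum_{k=0}^{N-1}\breve{\mathbf x}^r(k)e^{-i\omega k},\qquad \widehat\Phi_{\mathbf x}(\omega)=\frac1n\sum_{r=1}^n\mathbf x^r(\omega)\mathbf x^r(\omega)^*,\qquad \widetilde\Phi_{\mathbf x}(\omega)=\mathbb E\left[\mathbf x^r(\omega)\mathbf x^r(\omega)^*\right]$$ (the last matrix does not depend on $r$). Then, in both cases, for every $\omega\in[0,2\pi]$ and every $0\le\epsilon\le 12M$, $$\mathbb P\left(\left\|\widehat\Phi_{\mathbf x}(\omega)-\widetilde\Phi_{\mathbf x}(\omega)\right\|\ge\epsilon\right)\le\exp\left(-\frac{\epsilon^2n}{128M^2}+6p\right),$$ where $\|\cdot\|$ is the spectral norm. -/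

import Mathlib

open MeasureTheory ProbabilityTheory
open scoped Matrix.Norms.L2Operator

noncomputable section

namespace DDAG

/-- A directed graph is acyclic if no vertex can be reached from itself along directed edges. -/
def IsAcyclic {V : Type*} (G : Digraph V) : Prop :=
  ∀ i, ¬ Relation.TransGen G.Adj i i

section Model

variable {Ω : Type*} [MeasurableSpace Ω] {p : ℕ}

/-- The entry `(i, j)` of the auto-correlation matrix `R_z(k) = E[z(k) z(0)ᵀ]` of a vector
process `z`, where `z i k` is the `i`-th coordinate at time `k`. -/
def autocorr (μ : Measure Ω) (z : Fin p → ℤ → Ω → ℝ) (k : ℤ) : Matrix (Fin p) (Fin p) ℝ :=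
  Matrix.of fun i j => ∫ w, z i k w * z j 0 w ∂μ

/-- The power spectral density matrix `Φ_z(θ) = ∑ₖ R_z(k) e^{-iθk}`. -/
def psd (μ : Measure Ω) (z : Fin p → ℤ → Ω → ℝ) (θ : ℝ) : Matrix (Fin p) (Fin p) ℂ :=
  Matrix.of fun i j =>
    ∑' k : ℤ, (autocorr μ z k i j : ℂ) * Complex.exp (-(Complex.I * θ * k))

/-- The exogenous noise: a zero mean, wide-sense stationary, (jointly) Gaussian vector process,
uncorrelated across nodes, whose auto-correlation is summable (so that its power spectral density
is defined) with `Φ_e(θ) = σ(θ) I` on `[0, 2π]`. -/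
structure IsNoise (μ : Measure Ω) (e : Fin p → ℤ → Ω → ℝ) (σ : ℝ → ℝ) : Prop where
  gaussian : IsGaussianProcess (fun t : Fin p × ℤ => e t.1 t.2) μ
  mean_zero : ∀ i k, ∫ w, e i k w ∂μ = 0
  stationary : ∀ i (k m : ℤ), ∫ w, e i (k + m) w * e i m w ∂μ = ∫ w, e i k w * e i 0 w ∂μ
  uncorrelated : ∀ i j, i ≠ j → ∀ k m : ℤ, ∫ w, e i k w * e j m w ∂μ = 0
  summable : ∀ i, Summable fun k : ℤ => autocorr μ e k i i
  equal_psd : ∀ θ ∈ Set.Icc 0 (2 * Real.pi), psd μ e θ = (σ θ : ℂ) • 1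

open Classical in
/-- The process `x` is the state of the linear dynamical system on the directed acyclic graph `G`
with (possibly two-sided) filters `h i j` attached to the edges `j → i` and noise `e`:
`x_i(k) = ∑_{j → i} (h_ij ⋆ x_j)(k) + e_i(k)` almost surely, for all nodes `i` and times `k`. -/
structure IsLDS (μ : Measure Ω) (G : Digraph (Fin p)) (h : Fin p → Fin p → ℤ → ℝ)
    (σ : ℝ → ℝ) (e x : Fin p → ℤ → Ω → ℝ) : Prop where
  acyclic : IsAcyclic G
  filter_ne_zero : ∀ i j, G.Adj j i → h i j ≠ 0
  filter_summable : ∀ i j, G.Adj j i → Summable (h i j)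
  noise : IsNoise μ e σ
  measurable : ∀ i k, Measurable (x i k)
  conv_summable : ∀ i j, G.Adj j i → ∀ k : ℤ,
    ∀ᵐ w ∂μ, Summable fun l : ℤ => h i j l * x j (k - l) w
  evolution : ∀ i (k : ℤ), ∀ᵐ w ∂μ,
    x i k w = (∑ j with G.Adj j i, ∑' l : ℤ, h i j l * x j (k - l) w) + e i k w

/-- For every frequency in `[0, 2π]`, the eigenvalues of the (Hermitian) power spectral density
matrix of `x` lie in `[1/M, M]`. -/
def PSDBounded (μ : Measure Ω) (x : Fin p → ℤ → Ω → ℝ) (M : ℝ) : Prop :=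
  0 < M ∧ ∀ θ ∈ Set.Icc 0 (2 * Real.pi), ∃ hΦ : (psd μ x θ).IsHermitian,
    ∀ i, 1 / M ≤ hΦ.eigenvalues i ∧ hΦ.eigenvalues i ≤ M

/-- The `N` consecutive samples `x(t), …, x(t + N - 1)` as one random variable. -/
def window (x : Fin p → ℤ → Ω → ℝ) (N : ℕ) (t : ℤ) (w : Ω) : Fin N → Fin p → ℝ :=
  fun k i => x i (t + (k : ℕ)) w

/-- Restart and record: the `n` recorded trajectories (on a probability space of their own) are
independent, and each is distributed as `N` consecutive samples of the system state `x`. -/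
def IsRestartRecord {Ω' : Type*} [MeasurableSpace Ω'] {n N : ℕ} (μ : Measure Ω)
    (x : Fin p → ℤ → Ω → ℝ) (P : Measure Ω') (y : Fin n → Ω' → Fin N → Fin p → ℝ) : Prop :=
  iIndepFun y P ∧ ∀ r, IdentDistrib (y r) (window x N 0) P μ

/-- Continuous sampling: a single trajectory `x(0), …, x(nN - 1)` is cut into `n` consecutive
segments of `N` samples. -/
def segments (n N : ℕ) (x : Fin p → ℤ → Ω → ℝ) (r : Fin n) : Ω → Fin N → Fin p → ℝ :=
  window x N (((r : ℕ) * N : ℕ) : ℤ)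

end Model

section Spectrogram

variable {Ω : Type*} [MeasurableSpace Ω] {p n N : ℕ}

/-- The normalised Fourier transform `N^{-1/2} ∑_{k < N} y(k) e^{-iθk}` of a trajectory. -/
def dft (y : Fin N → Fin p → ℝ) (θ : ℝ) : Fin p → ℂ :=
  fun i => ((1 / Real.sqrt N : ℝ) : ℂ) *
    ∑ k : Fin N, (y k i : ℂ) * Complex.exp (-(Complex.I * θ * (k : ℕ)))

/-- The rank one matrix `v v*`. -/
def outer (v : Fin p → ℂ) : Matrix (Fin p) (Fin p) ℂ :=
  Matrix.vecMulVec v (star v)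

/-- The spectrogram estimator `(1/n) ∑_r x^r(θ) x^r(θ)*`, where `x^r(θ)` is the transform of the
`r`-th trajectory. -/
def spectrogram (y : Fin n → Fin N → Fin p → ℝ) (θ : ℝ) : Matrix (Fin p) (Fin p) ℂ :=
  (1 / n : ℂ) • ∑ r, outer (dft (y r) θ)

/-- The covariance matrix `E[x^r(θ) x^r(θ)*]` of the transform of a random trajectory. -/
def dftCov (P : Measure Ω) (y : Ω → Fin N → Fin p → ℝ) (θ : ℝ) : Matrix (Fin p) (Fin p) ℂ :=
  Matrix.of fun i j => ∫ w, outer (dft (y w) θ) i j ∂P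

end Spectrogram

end DDAG

end

/-! For a unit vector v, the quadratic form of the centred spectrogram at v is 1/n times the centred
squared norm of a Gaussian vector in ℝ^(2n), made of the real and imaginary parts of v* x^r for all
r. Concentration of this norm needs no independence between the x^r, only that the covariance of the
vector be at most M. After an orthogonal change of coordinates the squared norm is a sum of
independent squares with variances at most M, and Chernoff's method gives the tail 2
exp(-δ²n/(32M²)) for δ ≤ 6M (`measureReal_sum_sq_sub_integral_ge_le`). A 1/2-net of the unit sphere
of ℂ^p has at most 25^p points and controls the norm of a Hermitian matrix up to a factor 2. A union
bound with δ = ε/2, together with 2·25^p ≤ e^(6p) for p ≥ 1, gives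
`measureReal_spectrogram_sub_ge_le`.

It remains to see that the samples are centred and jointly Gaussian with covariance at most M.
Induction along the acyclic graph puts each x_i(k) in the closed L² span of the noise, all of whose
elements are centred Gaussian. The same induction gives stationarity and summable correlations. The
covariance of samples at distinct times is then a section of the block Toeplitz operator with symbol
Φ_x, so Φ_x ≤ M I bounds it by M (`IsLDS.integral_sq_sum_le`). Continuous segments occupy nN
distinct times, so this applies to them jointly; for restarted trajectories it applies to each one,
and independence makes the variances add. -/

noncomputable section

namespace DDAG

/-! ### Chernoff bound for the squared norm of a Gaussian vector -/

section GaussianQuadraticForm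

/-- The left side is E exp(t(W² - λ)) for W centred Gaussian of variance λ, with s = λt. The range s
≤ 3/8 is the one that ε ≤ 12M eventually requires. -/
lemma inv_sqrt_mul_exp_neg_le {s : ℝ} (hs : s ≤ 3 / 8) :
    (√(1 - 2 * s))⁻¹ * Real.exp (-s) ≤ Real.exp (4 * s ^ 2) := by
  have hpos : 0 < 1 - 2 * s := by linarith
  -- The square of the claim. Expanding the exponential to first order leaves the excess 4s²(1 -
  -- 4s), to second order 2s²(3 - 2s - 32s³); these are nonnegative on the two ranges of s.
  have key : 1 ≤ (1 - 2 * s) * Real.exp (2 * s + 8 * s ^ 2) := by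
    rcases le_or_gt s (1 / 4) with h | h
    · have h1 : 1 + (2 * s + 8 * s ^ 2) ≤ Real.exp (2 * s + 8 * s ^ 2) := by
        linarith [Real.add_one_le_exp (2 * s + 8 * s ^ 2)]
      calc (1 : ℝ) ≤ (1 - 2 * s) * (1 + (2 * s + 8 * s ^ 2)) := by
            nlinarith [mul_nonneg (sq_nonneg s) (sub_nonneg.2 h)]
        _ ≤ _ := by gcongr
    · have h1 := Real.quadratic_le_exp_of_nonneg (x := 2 * s + 8 * s ^ 2) (by positivity)
      have h3 : 0 ≤ 3 - 2 * s - 32 * s ^ 3 := by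
        have : s ^ 3 ≤ (3 / 8) ^ 3 := by gcongr
        norm_num at this
        linarith
      calc (1 : ℝ) ≤ (1 - 2 * s) *
              (1 + (2 * s + 8 * s ^ 2) + (2 * s + 8 * s ^ 2) ^ 2 / 2) := by
            nlinarith [mul_nonneg (sq_nonneg s) h3]
        _ ≤ _ := by gcongr
  have h2 : Real.exp (2 * s + 8 * s ^ 2) = (Real.exp (s + 4 * s ^ 2)) ^ 2 := by
    rw [← Real.exp_nat_mul]; ring_nf
  have h3 : 1 ≤ √(1 - 2 * s) * Real.exp (s + 4 * s ^ 2) := by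
    have : √((1 - 2 * s) * Real.exp (s + 4 * s ^ 2) ^ 2)
        = √(1 - 2 * s) * Real.exp (s + 4 * s ^ 2) := by
      rw [Real.sqrt_mul hpos.le, Real.sqrt_sq (Real.exp_nonneg _)]
    rw [← this, ← h2]
    exact Real.one_le_sqrt.2 key
  have hsq : 0 < √(1 - 2 * s) := Real.sqrt_pos.2 hpos
  rw [inv_mul_le_iff₀ hsq]
  calc Real.exp (-s) = 1 * Real.exp (-s) := by ring
    _ ≤ (√(1 - 2 * s) * Real.exp (s + 4 * s ^ 2)) * Real.exp (-s) := by gcongr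
    _ = _ := by rw [mul_assoc, ← Real.exp_add]; ring_nf

/-- The moment generating function of the square of a centred Gaussian variable. -/
lemma integrable_and_integral_exp_mul_sq_gaussianReal (v : NNReal) {t : ℝ} (ht : 2 * (v * t) < 1) :
    Integrable (fun x : ℝ => Real.exp (t * x ^ 2)) (gaussianReal 0 v) ∧
      ∫ x, Real.exp (t * x ^ 2) ∂gaussianReal 0 v = (√(1 - 2 * (v * t)))⁻¹ := by
  rcases eq_or_ne v 0 with rfl | hv
  · simp [gaussianReal_zero_var, integrable_dirac]
  have hv' : (0 : ℝ) < v := by positivity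
  have hb : 0 < 1 / (2 * (v : ℝ)) - t := by
    rw [sub_pos, lt_div_iff₀ (by positivity)]; linarith
  have hpt : ∀ x : ℝ, gaussianPDFReal 0 v x * Real.exp (t * x ^ 2)
      = (√(2 * Real.pi * v))⁻¹ * Real.exp (-(1 / (2 * (v : ℝ)) - t) * x ^ 2) := by
    intro x
    rw [gaussianPDFReal, mul_assoc, ← Real.exp_add]
    congr 2
    field_simp
    ring
  constructor
  · rw [gaussianReal_of_var_ne_zero _ hv]
    rw [integrable_withDensity_iff (measurable_gaussianPDF 0 v)
      (Filter.Eventually.of_forall fun x => gaussianPDF_lt_top)]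
    simp only [toReal_gaussianPDF]
    simp_rw [mul_comm (Real.exp _), hpt]
    exact (integrable_exp_neg_mul_sq hb).const_mul _
  · rw [integral_gaussianReal_eq_integral_smul hv]
    simp_rw [smul_eq_mul, hpt]
    rw [integral_const_mul, integral_gaussian, ← Real.sqrt_inv, ← Real.sqrt_inv,
      ← Real.sqrt_mul (by positivity)]
    congr 1
    have : 1 - 2 * ((v : ℝ) * t) ≠ 0 := by linarith
    field_simp

variable {ι : Type*} [Fintype ι]

/-- An eigenbasis of the second moment matrix decorrelates the coordinates; for a centred Gaussian
measure they are then independent. -/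
lemma exists_orthonormalBasis_integral_eq (ν : Measure (ι → ℝ))
    (hint : ∀ i, MemLp (fun z : ι → ℝ => z i) 2 ν) :
    ∃ b : OrthonormalBasis ι ℝ (EuclideanSpace ℝ ι), ∀ j l, j ≠ l →
      ∫ z, (∑ i, b j i * z i) * (∑ i, b l i * z i) ∂ν = 0 := by
  classical
  let C : Matrix ι ι ℝ := Matrix.of fun i k => ∫ z, z i * z k ∂ν
  have hC : C.IsHermitian := by
    ext i k
    simp [C, mul_comm]
  refine ⟨hC.eigenvectorBasis, fun j l hjl => ?_⟩
  have h1 : ∫ z, (∑ i, hC.eigenvectorBasis j i * z i) * (∑ i, hC.eigenvectorBasis l i * z i) ∂ν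
      = (hC.eigenvectorBasis j).ofLp ⬝ᵥ C.mulVec (hC.eigenvectorBasis l).ofLp := by
    simp_rw [Finset.sum_mul_sum]
    have hI : ∀ i k, Integrable (fun z : ι → ℝ => hC.eigenvectorBasis j i * z i *
        (hC.eigenvectorBasis l k * z k)) ν := fun i k =>
      ((hint i).const_mul _).integrable_mul ((hint k).const_mul _)
    rw [integral_finsetSum _ fun i _ => integrable_finsetSum _ fun k _ => hI i k]
    simp only [dotProduct, Matrix.mulVec]
    refine Finset.sum_congr rfl fun i _ => ?_
    rw [integral_finsetSum _ fun k _ => hI i k, Finset.mul_sum]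
    refine Finset.sum_congr rfl fun k _ => ?_
    simp only [C, Matrix.of_apply]
    rw [← integral_mul_const, ← integral_const_mul]
    congr 1; ext z; ring
  rw [h1, hC.mulVec_eigenvectorBasis, dotProduct_smul]
  have h2 : inner ℝ (hC.eigenvectorBasis l) (hC.eigenvectorBasis j) = 0 :=
    hC.eigenvectorBasis.orthonormal.2 hjl.symm
  rw [EuclideanSpace.inner_eq_star_dotProduct] at h2
  simp only [star_trivial] at h2
  rw [h2, smul_zero]

/-- The centred squared norm of a Gaussian vector whose covariance is bounded by `M` has
sub-Gaussian exponential moments near the origin. -/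
lemma integrable_and_mgf_sum_sq_le (ν : Measure (ι → ℝ)) [IsGaussian ν] {M : ℝ}
    (hmean : ∀ i, ∫ z, z i ∂ν = 0)
    (hvar : ∀ u : ι → ℝ, ∫ z, (∑ i, u i * z i) ^ 2 ∂ν ≤ M * ∑ i, u i ^ 2)
    {t : ℝ} (ht : M * t ≤ 3 / 8) (hM : 0 < M) :
    Integrable (fun z => Real.exp (t * (∑ i, z i ^ 2 - ∫ z, ∑ i, z i ^ 2 ∂ν))) ν ∧
      mgf (fun z => ∑ i, z i ^ 2 - ∫ z, ∑ i, z i ^ 2 ∂ν) ν t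
        ≤ Real.exp (4 * Fintype.card ι * (M * t) ^ 2) := by
  have hG : HasGaussianLaw (fun z : ι → ℝ => z) ν := IsGaussian.hasGaussianLaw_id
  have hint : ∀ i, MemLp (fun z : ι → ℝ => z i) 2 ν := fun i =>
    (hG.map_fun (ContinuousLinearMap.proj (R := ℝ) (φ := fun _ : ι => ℝ) i)).memLp_two
  obtain ⟨b, hb⟩ := exists_orthonormalBasis_integral_eq ν hint
  set W : ι → (ι → ℝ) → ℝ := fun j z => ∑ i, b j i * z i with hW
  have hWm : ∀ j, Measurable (W j) := fun j => by simp only [hW]; fun_prop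
  have hWG : HasGaussianLaw (fun z j => W j z) ν := by
    let L : (ι → ℝ) →L[ℝ] (ι → ℝ) := LinearMap.toContinuousLinearMap
      (LinearMap.pi fun j => ∑ i, b j i • LinearMap.proj i)
    convert! hG.map_fun L using 2 with z
    ext j
    simp [L, hW]
  have hWG1 : ∀ j, HasGaussianLaw (W j) ν := fun j =>
    hWG.map_fun (ContinuousLinearMap.proj (R := ℝ) (φ := fun _ : ι => ℝ) j)
  have hW2 : ∀ j, MemLp (W j) 2 ν := fun j => (hWG1 j).memLp_two
  have hW0 : ∀ j, ∫ z, W j z ∂ν = 0 := fun j => by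
    simp only [hW]
    rw [integral_finsetSum _ fun i _ => ((hint i).integrable (by norm_num)).const_mul _]
    simp [integral_const_mul, hmean]
  have hind : iIndepFun W ν := by
    refine hWG.iIndepFun_of_covariance_eq_zero fun j l hjl => ?_
    rw [covariance_eq_sub (hW2 j) (hW2 l), hW0, zero_mul, sub_zero]
    exact hb j l hjl
  -- Parseval: the rotation does not change the squared norm.
  have hsum : ∀ z : ι → ℝ, ∑ i, z i ^ 2 = ∑ j, W j z ^ 2 := by
    intro z
    have h1 := b.sum_sq_norm_inner_right (WithLp.toLp 2 z)
    rw [EuclideanSpace.norm_sq_eq] at h1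
    simp only [Real.norm_eq_abs, sq_abs] at h1
    rw [← h1]
    refine Finset.sum_congr rfl fun j _ => ?_
    simp [hW, PiLp.inner_apply, mul_comm]
  set lam : ι → ℝ := fun j => ∫ z, W j z ^ 2 ∂ν with hlam
  have hlamM : ∀ j, lam j ≤ M := by
    intro j
    have h1 := hvar (fun i => b j i)
    have h2 : ∑ i, b j i ^ 2 = 1 := by
      have := b.orthonormal.1 j
      have h3 := EuclideanSpace.norm_sq_eq (b j)
      rw [this] at h3
      simp only [Real.norm_eq_abs, sq_abs] at h3
      linarith
    rw [h2, mul_one] at h1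
    exact h1
  have hlam0 : ∀ j, 0 ≤ lam j := fun j => integral_nonneg fun z => sq_nonneg _
  have hEsum : ∫ z, ∑ i, z i ^ 2 ∂ν = ∑ j, lam j := by
    rw [funext hsum, integral_finsetSum _ fun j _ => (hW2 j).integrable_sq]
  have hfun : (fun z : ι → ℝ => ∑ i, z i ^ 2 - ∫ z, ∑ i, z i ^ 2 ∂ν)
      = ∑ j, fun z => (W j z ^ 2 - lam j) := by
    ext z
    rw [hEsum, hsum, ← Finset.sum_sub_distrib, Finset.sum_apply]
  have hind' : iIndepFun (fun j z => W j z ^ 2 - lam j) ν :=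
    hind.comp (fun j x => x ^ 2 - lam j) fun j => by fun_prop
  have hmeas' : ∀ j, Measurable fun z => W j z ^ 2 - lam j := fun j => by fun_prop
  have hone : ∀ j, Integrable (fun z => Real.exp (t * (W j z ^ 2 - lam j))) ν ∧
      mgf (fun z => W j z ^ 2 - lam j) ν t ≤ Real.exp (4 * (M * t) ^ 2) := by
    intro j
    have hlaw : ν.map (W j) = gaussianReal 0 (lam j).toNNReal := by
      rw [(hWG1 j).map_eq_gaussianReal, hW0, variance_of_integral_eq_zero (hWm j).aemeasurable
        (hW0 j)]
    -- Negative t, used for the lower tail, costs nothing: the product is then nonpositive.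
    have hst : lam j * t ≤ 3 / 8 := by
      rcases le_or_gt t 0 with h | h
      · nlinarith [hlam0 j]
      · nlinarith [hlamM j]
    have hcoe : ((lam j).toNNReal : ℝ) = lam j := Real.coe_toNNReal _ (hlam0 j)
    obtain ⟨h1, h2⟩ := integrable_and_integral_exp_mul_sq_gaussianReal (lam j).toNNReal (t := t)
      (by rw [hcoe]; linarith)
    rw [← hlaw] at h1 h2
    rw [hcoe] at h2
    have h3 : ∀ z, Real.exp (t * (W j z ^ 2 - lam j))
        = Real.exp (t * W j z ^ 2) * Real.exp (-(lam j * t)) := fun z => by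
      rw [← Real.exp_add]; ring_nf
    have h1' : Integrable (fun z => Real.exp (t * W j z ^ 2)) ν :=
      h1.comp_measurable (hWm j)
    constructor
    · simp_rw [h3]
      exact h1'.mul_const _
    · rw [mgf]
      simp_rw [h3]
      rw [integral_mul_const]
      rw [integral_map (hWm j).aemeasurable (by fun_prop)] at h2
      rw [h2]
      refine (inv_sqrt_mul_exp_neg_le hst).trans (Real.exp_le_exp.2 ?_)
      rw [mul_pow, mul_pow]
      have := hlam0 j
      gcongr
      exact hlamM j
  constructor
  · have := hind'.integrable_exp_mul_sum hmeas' (s := Finset.univ) fun j _ => (hone j).1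
    rw [← hfun] at this
    exact this
  · rw [hfun, hind'.mgf_sum hmeas']
    calc ∏ j, mgf (fun z => W j z ^ 2 - lam j) ν t
        ≤ ∏ _j : ι, Real.exp (4 * (M * t) ^ 2) :=
          Finset.prod_le_prod (fun j _ => mgf_nonneg) fun j _ => (hone j).2
      _ = _ := by
          rw [Finset.prod_const, ← Real.exp_nat_mul, Finset.card_univ]; ring_nf

/-- Two-sided tail bound for the squared norm of a Gaussian vector of dimension `2 n`. -/
lemma measureReal_sum_sq_sub_integral_ge_le {Ω : Type*} [MeasurableSpace Ω] {P : Measure Ω}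
    {Z : ι → Ω → ℝ} (hZ : HasGaussianLaw (fun w i => Z i w) P) {M : ℝ} (hM : 0 < M)
    (hmean : ∀ i, ∫ w, Z i w ∂P = 0)
    (hvar : ∀ u : ι → ℝ, ∫ w, (∑ i, u i * Z i w) ^ 2 ∂P ≤ M * ∑ i, u i ^ 2)
    {n : ℕ} (hn : Fintype.card ι = 2 * n) {δ : ℝ} (hδ : 0 ≤ δ) (hδM : δ ≤ 6 * M) :
    P.real {w | n * δ ≤ |∑ i, Z i w ^ 2 - ∫ w, ∑ i, Z i w ^ 2 ∂P|}
      ≤ 2 * Real.exp (-(δ ^ 2 * n / (32 * M ^ 2))) := by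
  have hP := hZ.isProbabilityMeasure
  have hae := hZ.aemeasurable
  set ν : Measure (ι → ℝ) := P.map (fun w i => Z i w) with hν
  have : IsGaussian ν := hZ.isGaussian_map
  have hmean' : ∀ i, ∫ z, z i ∂ν = 0 := fun i => by
    rw [hν, integral_map hae (by exact (measurable_pi_apply i).aestronglyMeasurable)]
    exact hmean i
  have hvar' : ∀ u : ι → ℝ, ∫ z, (∑ i, u i * z i) ^ 2 ∂ν ≤ M * ∑ i, u i ^ 2 := fun u => by
    rw [hν, integral_map hae (Continuous.aestronglyMeasurable (by fun_prop))]; exact hvar u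
  have hE : ∫ w, ∑ i, Z i w ^ 2 ∂P = ∫ z, ∑ i, z i ^ 2 ∂ν := by
    rw [hν, integral_map hae (Continuous.aestronglyMeasurable (by fun_prop))]
  set X : (ι → ℝ) → ℝ := fun z => ∑ i, z i ^ 2 - ∫ z, ∑ i, z i ^ 2 ∂ν with hX
  have htrans : P.real {w | n * δ ≤ |∑ i, Z i w ^ 2 - ∫ w, ∑ i, Z i w ^ 2 ∂P|}
      = ν.real {z | n * δ ≤ |X z|} := by
    rw [hν, map_measureReal_apply_of_aemeasurable hae
      (measurableSet_le (by fun_prop) (by fun_prop)), hE]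
    rfl
  rw [htrans]
  -- The parameter t = δ/(16M²) minimises -tnδ + 8n(Mt)², and δ ≤ 6M puts Mt in the admissible
  -- range.
  have hs : δ / (16 * M ^ 2) * M ≤ 3 / 8 := by
    rw [div_mul_eq_mul_div, div_le_iff₀ (by positivity)]
    nlinarith
  have ht0 : 0 ≤ δ / (16 * M ^ 2) := by positivity
  obtain ⟨i1, m1⟩ := integrable_and_mgf_sum_sq_le ν hmean' hvar' (t := δ / (16 * M ^ 2))
    (by linarith) hM
  obtain ⟨i2, m2⟩ := integrable_and_mgf_sum_sq_le ν hmean' hvar' (t := -(δ / (16 * M ^ 2)))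
    (by nlinarith) hM
  have u1 := measure_ge_le_exp_mul_mgf (n * δ) ht0 i1
  have u2 := measure_le_le_exp_mul_mgf (-(n * δ)) (neg_nonpos.2 ht0) i2
  -- In units of nδ²/M² the exponent is -1/16 + 8/256 = -1/32. It depends on s only through s², so
  -- it serves both tails.
  have hexp : ∀ s : ℝ, s ^ 2 = (δ / (16 * M ^ 2)) ^ 2 →
      Real.exp (-(δ / (16 * M ^ 2)) * (n * δ)) * Real.exp (4 * Fintype.card ι * (M * s) ^ 2)
        = Real.exp (-(δ ^ 2 * n / (32 * M ^ 2))) := by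
    intro s hs
    rw [← Real.exp_add, hn, mul_pow, hs]
    congr 1
    push_cast
    field_simp
    ring
  calc ν.real {z | n * δ ≤ |X z|}
      ≤ ν.real ({z | n * δ ≤ X z} ∪ {z | X z ≤ -(n * δ)}) := by
        refine measureReal_mono fun z hz => ?_
        rcases le_abs.1 hz.out with h | h
        · exact Or.inl h
        · exact Or.inr (show X z ≤ -(n * δ) by linarith)
    _ ≤ ν.real {z | n * δ ≤ X z} + ν.real {z | X z ≤ -(n * δ)} := measureReal_union_le _ _
    _ ≤ Real.exp (-(δ ^ 2 * n / (32 * M ^ 2))) + Real.exp (-(δ ^ 2 * n / (32 * M ^ 2))) := by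
        refine add_le_add (u1.trans ?_) (u2.trans ?_)
        · rw [← hexp _ rfl]; gcongr
        · rw [← hexp _ (neg_sq _)]
          have : -(-(δ / (16 * M ^ 2))) * (-(n * δ)) = -(δ / (16 * M ^ 2)) * (n * δ) := by ring
          rw [this]
          gcongr
    _ = _ := by ring

end GaussianQuadraticForm

/-! ### Nets of the sphere and the norm of Hermitian matrices -/

section Net

/-- The unit sphere of a finite dimensional space has a `1/2`-net with at most `5 ^ d` points. -/
lemma exists_net_unitSphere (E : Type*) [NormedAddCommGroup E] [NormedSpace ℝ E]
    [FiniteDimensional ℝ E] :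
    ∃ S : Finset E, S.card ≤ 5 ^ Module.finrank ℝ E ∧ (∀ v ∈ S, ‖v‖ = 1) ∧
      ∀ v : E, ‖v‖ = 1 → ∃ w ∈ S, ‖v - w‖ ≤ 1 / 2 := by
  classical
  let Q : Finset E → Prop := fun S => (∀ v ∈ S, ‖v‖ = 1) ∧
    ∀ v ∈ S, ∀ w ∈ S, v ≠ w → 1 / 2 ≤ ‖v - w‖
  have hcard : ∀ S, Q S → S.card ≤ 5 ^ Module.finrank ℝ E := by
    intro S hS
    -- Doubling turns a 1/2-separated set in the unit sphere into a 1-separated set in the ball of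
    -- radius 2, the setting of the packing bound 5^d.
    have hinj : Function.Injective fun v : E => (2 : ℝ) • v :=
      smul_right_injective E two_ne_zero
    rw [← Finset.card_image_of_injective S hinj]
    refine Besicovitch.card_le_of_separated _ ?_ ?_
    · simp only [Finset.mem_image, forall_exists_index, and_imp]
      rintro _ v hv rfl
      rw [norm_smul, hS.1 v hv]; norm_num
    · simp only [Finset.mem_image, forall_exists_index, and_imp]
      rintro _ v hv rfl _ w hw rfl hvw
      have hne : v ≠ w := fun h => hvw (by rw [h])
      have := hS.2 v hv w hw hne
      rw [← smul_sub, norm_smul, Real.norm_ofNat]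
      linarith
  -- A separated set of maximal cardinality is a net, since any uncovered unit vector could be added
  -- to it.
  let A : Set ℕ := {k | ∃ S, Q S ∧ S.card = k}
  have hA : A.Nonempty := ⟨0, ∅, by simp [Q], rfl⟩
  have hAb : BddAbove A := ⟨5 ^ Module.finrank ℝ E, by rintro _ ⟨S, hS, rfl⟩; exact hcard S hS⟩
  obtain ⟨S, hS, hSc⟩ := Nat.sSup_mem hA hAb
  refine ⟨S, hcard S hS, hS.1, fun v hv => ?_⟩
  by_contra! hcon
  have hvS : v ∉ S := fun h => by
    have := hcon v h
    norm_num at this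
  have hQ : Q (insert v S) := by
    refine ⟨fun w hw => ?_, fun w hw u hu hwu => ?_⟩
    · rcases Finset.mem_insert.1 hw with rfl | h
      exacts [hv, hS.1 w h]
    · rcases Finset.mem_insert.1 hw with rfl | h <;> rcases Finset.mem_insert.1 hu with rfl | h'
      · exact absurd rfl hwu
      · exact (hcon u h').le
      · rw [norm_sub_rev]; exact (hcon w h).le
      · exact hS.2 w h u h' hwu
  have := le_csSup hAb ⟨_, hQ, rfl⟩
  rw [Finset.card_insert_of_notMem hvS, hSc] at this
  omega

variable {E : Type*} [NormedAddCommGroup E] [InnerProductSpace ℂ E]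

/-- The quadratic form of a symmetric operator near a unit eigenvector. -/
lemma norm_le_two_mul_norm_inner_of_hasEigenvector {T : E →L[ℂ] E}
    (hT : (T : E →ₗ[ℂ] E).IsSymmetric) {l : ℂ} (hl : ‖l‖ = ‖T‖) {v w : E} (hv : ‖v‖ = 1)
    (hTv : T v = l • v) (hw : ‖w‖ = 1) (hvw : ‖v - w‖ ≤ 1 / 2) :
    ‖T‖ ≤ 2 * ‖inner ℂ w (T w)‖ := by
  set a : ℂ := inner ℂ v w with ha
  set u : E := w - a • v with hu
  have hvv : inner ℂ v v = (1 : ℂ) := by simp [inner_self_eq_norm_sq_to_K, hv]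
  have hvu : inner ℂ v u = (0 : ℂ) := by
    rw [hu, inner_sub_right, inner_smul_right, hvv, ← ha]; ring
  have hvTu : inner ℂ v (T u) = (0 : ℂ) := by
    have := hT v u
    simp only [ContinuousLinearMap.coe_coe] at this
    rw [← this, hTv, inner_smul_left, hvu, mul_zero]
  have hw' : w = a • v + u := by rw [hu]; abel
  have huv : inner ℂ u v = (0 : ℂ) := by rw [← inner_conj_symm, hvu, map_zero]
  -- Symmetry makes T preserve the orthogonal complement of the eigenvector v, so the cross terms
  -- vanish. This is what makes a net as coarse as 1/2 sufficient.
  have hquad : inner ℂ w (T w) = (‖a‖ ^ 2 : ℝ) * l + inner ℂ u (T u) := by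
    conv_lhs => rw [hw']
    rw [map_add, map_smul, hTv]
    simp only [inner_add_left, inner_add_right, inner_smul_left, inner_smul_right, hvTu, huv, hvv]
    have : (starRingEnd ℂ) a * a = (‖a‖ ^ 2 : ℝ) := by
      rw [RCLike.conj_mul]; push_cast; rfl
    rw [← this]; ring
  have hnorm : ‖u‖ ^ 2 = 1 - ‖a‖ ^ 2 := by
    have h1 : ‖w‖ ^ 2 = ‖a • v‖ ^ 2 + ‖u‖ ^ 2 := by
      rw [hw']
      have : inner ℂ (a • v) u = (0 : ℂ) := by rw [inner_smul_left, hvu, mul_zero]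
      have := norm_add_sq_eq_norm_sq_add_norm_sq_of_inner_eq_zero _ _ this
      nlinarith
    rw [hw, norm_smul, hv] at h1
    linarith
  -- From 2 - 2 Re a = ‖v - w‖² ≤ 1/4.
  have hre : 7 / 8 ≤ ‖a‖ := by
    have h1 := norm_sub_sq (𝕜 := ℂ) v w
    rw [hv, hw] at h1
    have h2 : ‖v - w‖ ^ 2 ≤ (1 / 2) ^ 2 := by gcongr
    have h3 : RCLike.re (inner ℂ v w) ≤ ‖a‖ := RCLike.re_le_norm _
    linarith
  have hTu : ‖inner ℂ u (T u)‖ ≤ ‖T‖ * (1 - ‖a‖ ^ 2) := by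
    rw [← hnorm]
    calc ‖inner ℂ u (T u)‖ ≤ ‖u‖ * ‖T u‖ := norm_inner_le_norm _ _
      _ ≤ ‖u‖ * (‖T‖ * ‖u‖) := by gcongr; exact T.le_opNorm u
      _ = _ := by ring
  have hmain : ‖a‖ ^ 2 * ‖T‖ - ‖T‖ * (1 - ‖a‖ ^ 2) ≤ ‖inner ℂ w (T w)‖ := by
    have h1 : ‖((‖a‖ ^ 2 : ℝ) : ℂ) * l‖ = ‖a‖ ^ 2 * ‖T‖ := by
      rw [norm_mul, hl, Complex.norm_real, Real.norm_of_nonneg (by positivity)]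
    have h2 := norm_sub_le (inner ℂ w (T w)) (inner ℂ u (T u))
    have h3 : inner ℂ w (T w) - inner ℂ u (T u) = (‖a‖ ^ 2 : ℝ) * l := by rw [hquad]; ring
    rw [h3, h1] at h2
    linarith
  have hT0 : 0 ≤ ‖T‖ := norm_nonneg _
  -- The constant is 2(7/8)² - 1 = 17/32 ≥ 1/2.
  nlinarith [mul_nonneg hT0 (show 0 ≤ ‖a‖ ^ 2 - (7 / 8) ^ 2 by nlinarith)]

/-- The spectral norm of a nontrivial Hermitian matrix is attained by an eigenvalue. -/
lemma exists_unit_eigenvector_norm_eq {p : ℕ} (hp : 0 < p) {A : Matrix (Fin p) (Fin p) ℂ}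
    (hA : A.IsHermitian) :
    ∃ (l : ℂ) (v : EuclideanSpace ℂ (Fin p)), ‖l‖ = ‖A‖ ∧ ‖v‖ = 1 ∧
      Matrix.toEuclideanCLM (𝕜 := ℂ) A v = l • v := by
  have : NeZero p := ⟨hp.ne'⟩
  obtain ⟨l, hl, hlr⟩ := spectrum.exists_nnnorm_eq_spectralRadius A
  rw [IsSelfAdjoint.spectralRadius_eq_nnnorm hA.isSelfAdjoint] at hlr
  have hln : ‖l‖ = ‖A‖ := by
    have : ‖l‖₊ = ‖A‖₊ := by exact_mod_cast hlr
    simpa using congrArg NNReal.toReal this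
  rw [← Matrix.spectrum_toLpLin 2, ← Module.End.hasEigenvalue_iff_mem_spectrum] at hl
  obtain ⟨v, hv⟩ := hl.exists_hasEigenvector
  have hv0 : ‖v‖ ≠ 0 := norm_ne_zero_iff.2 hv.2
  refine ⟨l, ((‖v‖⁻¹ : ℝ) : ℂ) • v, hln, ?_, ?_⟩
  · rw [norm_smul]; simp [hv0]
  · rw [map_smul, smul_comm]
    congr 1
    exact hv.apply_eq_smul

lemma exists_net_norm_hermitian {p : ℕ} (hp : 0 < p) :
    ∃ S : Finset (EuclideanSpace ℂ (Fin p)), S.card ≤ 25 ^ p ∧ (∀ v ∈ S, ‖v‖ = 1) ∧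
      ∀ A : Matrix (Fin p) (Fin p) ℂ, A.IsHermitian → ∃ v ∈ S,
        ‖A‖ ≤ 2 * ‖star v.ofLp ⬝ᵥ A.mulVec v.ofLp‖ := by
  obtain ⟨S, hS, hS1, hnet⟩ := exists_net_unitSphere (EuclideanSpace ℂ (Fin p))
  -- The net lives in the underlying real space, of dimension 2p; hence 5^(2p) = 25^p.
  have hrank : Module.finrank ℝ (EuclideanSpace ℂ (Fin p)) = 2 * p := by
    rw [finrank_real_of_complex]; simp
  refine ⟨S, ?_, hS1, fun A hA => ?_⟩
  · rwa [hrank, pow_mul] at hS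
  obtain ⟨l, v, hl, hv, hAv⟩ := exists_unit_eigenvector_norm_eq hp hA
  obtain ⟨w, hwS, hvw⟩ := hnet v hv
  refine ⟨w, hwS, ?_⟩
  have hsym : (Matrix.toEuclideanCLM (𝕜 := ℂ) A :
      EuclideanSpace ℂ (Fin p) →ₗ[ℂ] EuclideanSpace ℂ (Fin p)).IsSymmetric :=
    Matrix.isSymmetric_toEuclideanLin_iff.2 hA
  have := norm_le_two_mul_norm_inner_of_hasEigenvector hsym
    (by rw [hl, Matrix.l2_opNorm_def]; rfl) hv hAv (hS1 w hwS) hvw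
  convert! this using 3
  rw [EuclideanSpace.inner_eq_star_dotProduct, dotProduct_comm]
  rfl

end Net

/-! ### From quadratic forms to the spectral norm of the spectrogram -/

section SpectrogramTail

lemma star_dotProduct_outer_mulVec {p : ℕ} (v x : Fin p → ℂ) :
    star v ⬝ᵥ (outer x).mulVec v = (Complex.normSq (star v ⬝ᵥ x) : ℂ) := by
  rw [outer, Matrix.vecMulVec_mulVec, dotProduct_smul, Complex.normSq_eq_conj_mul_self]
  have : (starRingEnd ℂ) (star v ⬝ᵥ x) = star x ⬝ᵥ v := by
    rw [starRingEnd_apply, Matrix.star_dotProduct, star_star]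
  rw [this]
  simp [mul_comm]

lemma isHermitian_outer {p : ℕ} (x : Fin p → ℂ) : (outer x).IsHermitian := by
  ext i j
  simp [outer, Matrix.vecMulVec_apply, mul_comm]

/-- Coefficients of the real (`s = 0`) and imaginary (`s = 1`) part of `v* x`, for the transform
`x` of a trajectory, as linear functionals of the trajectory. -/
def dftCoeff {p : ℕ} (N : ℕ) (v : Fin p → ℂ) (θ : ℝ) (t : Fin N × Fin p) : ℂ :=
  star (v t.2) * (((1 / Real.sqrt N : ℝ) : ℂ) * Complex.exp (-(Complex.I * θ * (t.1 : ℕ))))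

lemma star_dotProduct_dft {p N : ℕ} (v : Fin p → ℂ) (θ : ℝ) (y : Fin N → Fin p → ℝ) :
    star v ⬝ᵥ dft y θ = ∑ t, dftCoeff N v θ t * (y t.1 t.2 : ℂ) := by
  simp only [dotProduct, dft, dftCoeff, Fintype.sum_prod_type, Pi.star_apply, Finset.mul_sum]
  rw [Finset.sum_comm]
  refine Finset.sum_congr rfl fun k _ => Finset.sum_congr rfl fun i _ => ?_
  ring

/-- The phases have modulus one and the factor 1/N cancels the N times. This normalisation lets the
covariance bound M pass unchanged from the samples to v* x^r. -/
lemma sum_normSq_dftCoeff {p N : ℕ} (hN : 0 < N) {v : EuclideanSpace ℂ (Fin p)} (hv : ‖v‖ = 1)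
    (θ : ℝ) : ∑ t, Complex.normSq (dftCoeff N v.ofLp θ t) = 1 := by
  have h1 : ∀ t : Fin N × Fin p, Complex.normSq (dftCoeff N v.ofLp θ t)
      = ‖v t.2‖ ^ 2 * (N : ℝ)⁻¹ := by
    intro t
    rw [Complex.normSq_eq_norm_sq, dftCoeff, norm_mul, norm_mul, norm_star, Complex.norm_real]
    have : ‖Complex.exp (-(Complex.I * θ * (t.1 : ℕ)))‖ = 1 := by
      rw [Complex.norm_exp]; simp
    rw [this, mul_one, mul_pow, Real.norm_eq_abs, sq_abs, div_pow, Real.sq_sqrt (by positivity)]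
    simp
  have h2 := EuclideanSpace.norm_sq_eq v
  rw [hv] at h2
  simp_rw [h1, Fintype.sum_prod_type, ← Finset.sum_mul, ← h2]
  have : (N : ℝ) ≠ 0 := by positivity
  simp [this]

variable {Ω : Type*} [MeasurableSpace Ω] {P : Measure Ω} {p n N : ℕ}

lemma integrable_outer_dft {y : Ω → Fin N → Fin p → ℝ}
    (hy : ∀ k i, MemLp (fun w => y w k i) 2 P) (θ : ℝ) (i j : Fin p) :
    Integrable (fun w => outer (dft (y w) θ) i j) P := by
  have h0 : ∀ k i, MemLp (fun w => (y w k i : ℂ)) 2 P := fun k i => (hy k i).ofReal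
  have h1 : ∀ i, MemLp (fun w => dft (y w) θ i) 2 P := fun i => by
    have h : MemLp (fun w => ∑ k : Fin N, (y w k i : ℂ) *
        Complex.exp (-(Complex.I * θ * (k : ℕ)))) 2 P :=
      memLp_finsetSum _ fun k _ => (h0 k i).mul_const _
    exact h.const_mul _
  have h2 : MemLp (fun w => star (dft (y w) θ j)) 2 P := (h1 j).star
  exact (h1 i).integrable_mul h2

lemma star_dotProduct_dftCov_mulVec {y : Ω → Fin N → Fin p → ℝ}
    (hy : ∀ k i, MemLp (fun w => y w k i) 2 P) (θ : ℝ) (v : Fin p → ℂ) :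
    star v ⬝ᵥ (dftCov P y θ).mulVec v
      = ((∫ w, Complex.normSq (star v ⬝ᵥ dft (y w) θ) ∂P : ℝ) : ℂ) := by
  rw [← integral_complex_ofReal]
  simp_rw [← star_dotProduct_outer_mulVec]
  simp only [dotProduct, Matrix.mulVec, dftCov, Matrix.of_apply]
  have hI := integrable_outer_dft hy θ
  rw [integral_finsetSum _ fun i _ =>
    (integrable_finsetSum _ fun j _ => (hI i j).mul_const _).const_mul _]
  refine Finset.sum_congr rfl fun i _ => ?_
  rw [integral_const_mul, integral_finsetSum _ fun j _ => (hI i j).mul_const _]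
  simp_rw [integral_mul_const]

lemma isHermitian_dftCov (y : Ω → Fin N → Fin p → ℝ) (θ : ℝ) : (dftCov P y θ).IsHermitian := by
  ext i j
  simp only [Matrix.conjTranspose_apply, dftCov, Matrix.of_apply]
  rw [← starRingEnd_apply, ← integral_conj]
  congr 1
  ext w
  exact (isHermitian_outer (dft (y w) θ)).apply i j

lemma isHermitian_spectrogram (y : Fin n → Fin N → Fin p → ℝ) (θ : ℝ) :
    (spectrogram y θ).IsHermitian := by
  rw [Matrix.IsHermitian, spectrogram, Matrix.conjTranspose_smul, Matrix.conjTranspose_sum]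
  congr 1
  · simp
  · exact Finset.sum_congr rfl fun r _ => isHermitian_outer _

/-- Tail bound for one quadratic form of the centred spectrogram. -/
lemma measureReal_quadraticForm_spectrogram_ge_le (hn : 0 < n) (hN : 0 < N)
    {y : Fin n → Ω → Fin N → Fin p → ℝ}
    (hG : HasGaussianLaw (fun w (t : Fin n × Fin N × Fin p) => y t.1 w t.2.1 t.2.2) P)
    (h0 : ∀ r k i, ∫ w, y r w k i ∂P = 0) {M : ℝ} (hM : 0 < M)
    (hV : ∀ c : Fin n × Fin N × Fin p → ℝ,
      ∫ w, (∑ t, c t * y t.1 w t.2.1 t.2.2) ^ 2 ∂P ≤ M * ∑ t, c t ^ 2)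
    {θ : ℝ} {D : Matrix (Fin p) (Fin p) ℂ} (hD : ∀ r, dftCov P (y r) θ = D)
    {v : EuclideanSpace ℂ (Fin p)} (hv : ‖v‖ = 1) {δ : ℝ} (hδ : 0 ≤ δ) (hδM : δ ≤ 6 * M) :
    P.real {w | δ ≤ ‖star v.ofLp ⬝ᵥ (spectrogram (fun r => y r w) θ - D).mulVec v.ofLp‖}
      ≤ 2 * Real.exp (-(δ ^ 2 * n / (32 * M ^ 2))) := by
  have hmem : ∀ r k i, MemLp (fun w => y r w k i) 2 P := fun r k i =>
    (hG.map_fun (ContinuousLinearMap.proj (R := ℝ)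
      (φ := fun _ : Fin n × Fin N × Fin p => ℝ) (r, k, i))).memLp_two
  -- Real and imaginary parts of v* x^r become separate real coordinates, giving 2n of them.
  let β : Fin 2 → Fin N × Fin p → ℝ := fun s t =>
    if s = 0 then (dftCoeff N v.ofLp θ t).re else (dftCoeff N v.ofLp θ t).im
  let Z : Fin n × Fin 2 → Ω → ℝ := fun a w => ∑ t, β a.2 t * y a.1 w t.1 t.2
  have hβ : ∑ t, (β 0 t ^ 2 + β 1 t ^ 2) = 1 := by
    rw [← sum_normSq_dftCoeff hN hv θ]
    refine Finset.sum_congr rfl fun t _ => ?_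
    simp [β, Complex.normSq_apply]; ring
  have hZsq : ∀ r w, Complex.normSq (star v.ofLp ⬝ᵥ dft (y r w) θ)
      = Z (r, 0) w ^ 2 + Z (r, 1) w ^ 2 := by
    intro r w
    rw [star_dotProduct_dft, Complex.normSq_apply, Complex.re_sum, Complex.im_sum]
    simp [Z, β]; ring
  have hsumsq : ∀ w, ∑ a, Z a w ^ 2
      = ∑ r, Complex.normSq (star v.ofLp ⬝ᵥ dft (y r w) θ) := by
    intro w
    simp_rw [Fintype.sum_prod_type, Fin.sum_univ_two, hZsq]
  have hZmem : ∀ a, MemLp (Z a) 2 P := fun a =>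
    memLp_finsetSum _ fun t _ => (hmem a.1 t.1 t.2).const_mul _
  have hZG : HasGaussianLaw (fun w a => Z a w) P := by
    let L : (Fin n × Fin N × Fin p → ℝ) →L[ℝ] (Fin n × Fin 2 → ℝ) :=
      LinearMap.toContinuousLinearMap
        (LinearMap.pi fun a => ∑ t : Fin N × Fin p, β a.2 t • LinearMap.proj (a.1, t))
    convert! hG.map_fun L using 2 with w
    ext a
    simp [L, Z]
  have hZ0 : ∀ a, ∫ w, Z a w ∂P = 0 := fun a => by
    have := hG.isProbabilityMeasure
    simp only [Z]
    rw [integral_finsetSum _ fun t _ => ((hmem _ _ _).integrable (by norm_num)).const_mul _]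
    simp [integral_const_mul, h0]
  have hZV : ∀ u : Fin n × Fin 2 → ℝ,
      ∫ w, (∑ a, u a * Z a w) ^ 2 ∂P ≤ M * ∑ a, u a ^ 2 := by
    intro u
    let c : Fin n × Fin N × Fin p → ℝ := fun t => ∑ s, u (t.1, s) * β s t.2
    have h1 : ∀ w, ∑ a, u a * Z a w = ∑ t, c t * y t.1 w t.2.1 t.2.2 := by
      intro w
      rw [Fintype.sum_prod_type, Fintype.sum_prod_type]
      refine Finset.sum_congr rfl fun r _ => ?_
      simp only [Z, c, Finset.mul_sum, Finset.sum_mul]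
      rw [Finset.sum_comm]
      exact Finset.sum_congr rfl fun t _ => Finset.sum_congr rfl fun s _ => by ring
    -- Cauchy–Schwarz in the two-valued index s, then the normalisation of β.
    have h2 : ∑ t, c t ^ 2 ≤ ∑ a, u a ^ 2 := by
      rw [Fintype.sum_prod_type, Fintype.sum_prod_type]
      refine Finset.sum_le_sum fun r _ => ?_
      calc ∑ t, c (r, t) ^ 2
          ≤ ∑ t, (u (r, 0) ^ 2 + u (r, 1) ^ 2) * (β 0 t ^ 2 + β 1 t ^ 2) := by
            refine Finset.sum_le_sum fun t _ => ?_
            simp only [c, Fin.sum_univ_two]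
            nlinarith [sq_nonneg (u (r, 0) * β 1 t - u (r, 1) * β 0 t)]
        _ = ∑ s, u (r, s) ^ 2 := by
            rw [← Finset.mul_sum, hβ, mul_one, Fin.sum_univ_two]
    simp_rw [h1]
    exact (hV c).trans (by gcongr)
  have hE : ∫ w, ∑ a, Z a w ^ 2 ∂P
      = ∑ r, ∫ w, Complex.normSq (star v.ofLp ⬝ᵥ dft (y r w) θ) ∂P := by
    simp_rw [hsumsq]
    rw [integral_finsetSum]
    intro r _
    simp_rw [hZsq]
    exact (hZmem _).integrable_sq.add (hZmem _).integrable_sq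
  have hn' : (n : ℝ) ≠ 0 := by positivity
  have hquad : ∀ w, star v.ofLp ⬝ᵥ (spectrogram (fun r => y r w) θ - D).mulVec v.ofLp
      = (((n : ℝ)⁻¹ * (∑ a, Z a w ^ 2 - ∫ w, ∑ a, Z a w ^ 2 ∂P) : ℝ) : ℂ) := by
    intro w
    have hDq : (n : ℂ) * (star v.ofLp ⬝ᵥ D.mulVec v.ofLp)
        = ((∫ w, ∑ a, Z a w ^ 2 ∂P : ℝ) : ℂ) := by
      rw [hE, Complex.ofReal_sum]
      have h1 : ∀ r, ((∫ w, Complex.normSq (star v.ofLp ⬝ᵥ dft (y r w) θ) ∂P : ℝ) : ℂ)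
          = star v.ofLp ⬝ᵥ D.mulVec v.ofLp := fun r => by
        rw [← star_dotProduct_dftCov_mulVec (hmem r), hD]
      simp [h1]
    have hS : (n : ℂ) * (star v.ofLp ⬝ᵥ (spectrogram (fun r => y r w) θ).mulVec v.ofLp)
        = ((∑ a, Z a w ^ 2 : ℝ) : ℂ) := by
      rw [hsumsq, spectrogram, Matrix.smul_mulVec, dotProduct_smul, Matrix.sum_mulVec,
        dotProduct_sum, Complex.ofReal_sum]
      simp_rw [star_dotProduct_outer_mulVec]
      have : (n : ℂ) ≠ 0 := by exact_mod_cast hn.ne'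
      rw [smul_eq_mul]
      field_simp
    have hnc : (n : ℂ) ≠ 0 := by exact_mod_cast hn.ne'
    rw [Matrix.sub_mulVec, dotProduct_sub, Complex.ofReal_mul, Complex.ofReal_sub, ← hS, ← hDq]
    push_cast
    field_simp
  have hset : {w | δ ≤ ‖star v.ofLp ⬝ᵥ (spectrogram (fun r => y r w) θ - D).mulVec v.ofLp‖}
      = {w | n * δ ≤ |∑ a, Z a w ^ 2 - ∫ w, ∑ a, Z a w ^ 2 ∂P|} := by
    ext w
    have hnp : (0 : ℝ) < n := by positivity
    rw [Set.mem_ofPred_eq, Set.mem_ofPred_eq, hquad, Complex.norm_real, Real.norm_eq_abs, abs_mul, abs_of_pos (inv_pos.2 hnp),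
      le_inv_mul_iff₀ hnp]
  rw [hset]
  exact measureReal_sum_sq_sub_integral_ge_le hZG hM hZ0 hZV (by simp [mul_comm]) hδ hδM

/-- Concentration of the spectrogram of jointly Gaussian trajectories whose joint covariance is
bounded by `M`. -/
lemma measureReal_spectrogram_sub_ge_le (hn : 0 < n) (hN : 0 < N)
    {y : Fin n → Ω → Fin N → Fin p → ℝ}
    (hG : HasGaussianLaw (fun w (t : Fin n × Fin N × Fin p) => y t.1 w t.2.1 t.2.2) P)
    (h0 : ∀ r k i, ∫ w, y r w k i ∂P = 0) {M : ℝ} (hM : 0 < M)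
    (hV : ∀ c : Fin n × Fin N × Fin p → ℝ,
      ∫ w, (∑ t, c t * y t.1 w t.2.1 t.2.2) ^ 2 ∂P ≤ M * ∑ t, c t ^ 2)
    {θ : ℝ} {D : Matrix (Fin p) (Fin p) ℂ} (hD : ∀ r, dftCov P (y r) θ = D)
    {ε : ℝ} (hε : 0 ≤ ε) (hεM : ε ≤ 12 * M) :
    P.real {w | ε ≤ ‖spectrogram (fun r => y r w) θ - D‖}
      ≤ Real.exp (-(ε ^ 2 * n / (128 * M ^ 2)) + 6 * p) := by
  have hP := hG.isProbabilityMeasure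
  -- For p = 0 the matrices vanish and the sphere is empty. The bound is trivial when ε = 0, and the
  -- event is empty when ε > 0.
  rcases Nat.eq_zero_or_pos p with rfl | hp
  · rcases hε.eq_or_lt with rfl | hε
    · simp
    · have : {w | ε ≤ ‖spectrogram (fun r => y r w) θ - D‖} = ∅ := by
        refine Set.eq_empty_of_forall_notMem fun w hw => ?_
        have h1 : spectrogram (fun r => y r w) θ - D = 0 := Subsingleton.elim _ _
        have h2 : ε ≤ ‖spectrogram (fun r => y r w) θ - D‖ := hw
        rw [h1, norm_zero] at h2
        linarith
      rw [this, measureReal_empty]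
      positivity
  obtain ⟨S, hS, hS1, hnet⟩ := exists_net_norm_hermitian hp
  have hDh : D.IsHermitian := by
    rw [← hD ⟨0, hn⟩]; exact isHermitian_dftCov _ _
  calc P.real {w | ε ≤ ‖spectrogram (fun r => y r w) θ - D‖}
      ≤ P.real (⋃ v ∈ S, {w | ε / 2 ≤
          ‖star v.ofLp ⬝ᵥ (spectrogram (fun r => y r w) θ - D).mulVec v.ofLp‖}) := by
        refine measureReal_mono (fun w hw => ?_) (measure_ne_top _ _)
        obtain ⟨v, hvS, hle⟩ := hnet _ ((isHermitian_spectrogram (fun r => y r w) θ).sub hDh)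
        refine Set.mem_iUnion₂.2 ⟨v, hvS, ?_⟩
        have h2 : ε ≤ ‖spectrogram (fun r => y r w) θ - D‖ := hw
        rw [Set.mem_ofPred_eq]
        linarith
    _ ≤ ∑ v ∈ S, P.real {w | ε / 2 ≤
          ‖star v.ofLp ⬝ᵥ (spectrogram (fun r => y r w) θ - D).mulVec v.ofLp‖} :=
        measureReal_biUnion_finset_le _ _
    _ ≤ ∑ v ∈ S, 2 * Real.exp (-((ε / 2) ^ 2 * n / (32 * M ^ 2))) :=
        Finset.sum_le_sum fun v hv => measureReal_quadraticForm_spectrogram_ge_le hn hN hG h0 hM hV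
          hD (hS1 v hv) (by positivity) (by linarith)
    _ ≤ (2 * 25 ^ p) * Real.exp (-(ε ^ 2 * n / (128 * M ^ 2))) := by
        rw [Finset.sum_const, nsmul_eq_mul]
        have h1 : (ε / 2) ^ 2 * n / (32 * M ^ 2) = ε ^ 2 * n / (128 * M ^ 2) := by
          field_simp; ring
        have h2 : (S.card : ℝ) ≤ 25 ^ p := by exact_mod_cast hS
        rw [h1]
        nlinarith [Real.exp_pos (-(ε ^ 2 * n / (128 * M ^ 2)))]
    _ ≤ Real.exp (6 * p) * Real.exp (-(ε ^ 2 * n / (128 * M ^ 2))) := by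
        gcongr
        have h3 : (50 : ℝ) ≤ Real.exp 6 := by
          have h4 : (2 : ℝ) ≤ Real.exp 1 := by linarith [Real.add_one_le_exp (1 : ℝ)]
          calc (50 : ℝ) ≤ 2 ^ 6 := by norm_num
            _ ≤ Real.exp 1 ^ 6 := by gcongr
            _ = Real.exp 6 := by rw [← Real.exp_nat_mul]; norm_num
        -- The factor 2 from the two tails is absorbed into 2^p because p ≥ 1.
        calc (2 : ℝ) * 25 ^ p ≤ 2 ^ p * 25 ^ p := by
              gcongr
              exact le_self_pow₀ (by norm_num) hp.ne'
          _ = 50 ^ p := by rw [← mul_pow]; norm_num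
          _ ≤ Real.exp 6 ^ p := by gcongr
          _ = Real.exp (6 * p) := by rw [← Real.exp_nat_mul, mul_comm]
    _ = _ := by rw [← Real.exp_add, add_comm]

end SpectrogramTail

/-! ### Joint stationarity of sequences in a Hilbert space -/

section JointStationarity

variable {H : Type*} [NormedAddCommGroup H] [InnerProductSpace ℝ H]

/-- Two sequences in a Hilbert space are jointly stationary with summable cross-correlation. -/
def JointlyStationary (X Y : ℤ → H) : Prop :=
  (∀ k m, inner ℝ (X (k + m)) (Y m) = inner ℝ (X k) (Y 0)) ∧
    Summable fun k => inner ℝ (X k) (Y 0)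

namespace JointlyStationary

variable {X Y Z : ℤ → H}

lemma symm (h : JointlyStationary X Y) : JointlyStationary Y X := by
  have key : ∀ k m, inner ℝ (Y (k + m)) (X m) = inner ℝ (X (-k)) (Y 0) := fun k m => by
    rw [real_inner_comm, ← h.1 (-k) (k + m)]
    congr 2
    ring
  have key0 : ∀ k, inner ℝ (Y k) (X 0) = inner ℝ (X (-k)) (Y 0) := fun k => by
    simpa using key k 0
  refine ⟨fun k m => by rw [key, key0], ?_⟩
  simp_rw [key0]
  exact (Equiv.neg ℤ).summable_iff.2 h.2

lemma add (hX : JointlyStationary X Z) (hY : JointlyStationary Y Z) :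
    JointlyStationary (fun k => X k + Y k) Z :=
  ⟨fun k m => by simp only [inner_add_left, hX.1, hY.1],
    by simpa only [inner_add_left] using hX.2.add hY.2⟩

lemma sum {ι : Type*} {s : Finset ι} {X : ι → ℤ → H} (hX : ∀ i ∈ s, JointlyStationary (X i) Z) :
    JointlyStationary (fun k => ∑ i ∈ s, X i k) Z :=
  ⟨fun k m => by
    simp only [sum_inner]
    exact Finset.sum_congr rfl fun i hi => (hX i hi).1 k m,
    by simpa only [sum_inner] using summable_sum fun i hi => (hX i hi).2⟩

end JointlyStationary

lemma summable_norm_filter {g : ℤ → ℝ} (hg : Summable g) {X : ℤ → H} {C : ℝ}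
    (hX : ∀ k, ‖X k‖ ≤ C) (k : ℤ) : Summable fun l => ‖g l • X (k - l)‖ := by
  refine Summable.of_nonneg_of_le (fun l => norm_nonneg _) (fun l => ?_) (hg.abs.mul_right C)
  rw [norm_smul, Real.norm_eq_abs]
  gcongr
  exact hX _

variable [CompleteSpace H]

/-- The inner product passes through the norm-convergent series, so the new cross-correlation is the
convolution of g with the old one. Its summability is that of a product family on ℤ × ℤ, reindexed
by (k, l) ↦ (l, k - l). -/
lemma JointlyStationary.filter {X Z : ℤ → H} (hX : JointlyStationary X Z) {g : ℤ → ℝ}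
    (hg : Summable g) {C : ℝ} (hC : ∀ k, ‖X k‖ ≤ C) :
    JointlyStationary (fun k => ∑' l, g l • X (k - l)) Z := by
  have hS : ∀ k, Summable fun l => g l • X (k - l) := fun k =>
    (summable_norm_filter hg hC k).of_norm
  have hin : ∀ k z, inner ℝ (∑' l, g l • X (k - l)) z = ∑' l, g l * inner ℝ (X (k - l)) z := by
    intro k z
    rw [real_inner_comm, ← innerSL_apply_apply ℝ, (innerSL ℝ z).map_tsum (hS k)]
    refine tsum_congr fun l => ?_
    rw [innerSL_apply_apply, inner_smul_right, real_inner_comm]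
  constructor
  · intro k m
    rw [hin, hin]
    refine tsum_congr fun l => ?_
    rw [← hX.1 (k - l) m, show k - l + m = k + m - l by ring]
  · simp_rw [hin]
    have h1 : Summable fun x : ℤ × ℤ => g x.1 * inner ℝ (X x.2) (Z 0) :=
      summable_mul_of_summable_norm hg.norm hX.2.norm
    have hinj : Function.Injective fun x : ℤ × ℤ => (x.2, x.1 - x.2) := by
      rintro ⟨a, b⟩ ⟨c, d⟩ h
      simp only [Prod.mk.injEq] at h ⊢
      omega
    exact (h1.comp_injective hinj).prod

end JointStationarity

/-! ### The Gaussian Hilbert space of the noise -/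

section GaussianSpace

variable {Ω : Type*} [MeasurableSpace Ω] {μ : Measure Ω}

/-- Since |e^(ia) - e^(ib)| ≤ |a - b| and the L¹ norm is at most the L² norm on a probability space,
characteristic functions are Lipschitz in L². -/
lemma norm_integral_cexp_sub_le [IsProbabilityMeasure μ] (t : ℝ) (f g : Lp ℝ 2 μ) :
    ‖∫ w, Complex.exp (Complex.I * (t * f w : ℝ)) ∂μ
      - ∫ w, Complex.exp (Complex.I * (t * g w : ℝ)) ∂μ‖ ≤ |t| * ‖f - g‖ := by
  have hI : ∀ f : Lp ℝ 2 μ, Integrable (fun w => Complex.exp (Complex.I * (t * f w : ℝ))) μ := by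
    intro f
    refine Integrable.of_bound (C := 1) ?_ (Filter.Eventually.of_forall fun w => ?_)
    · have := (Lp.aestronglyMeasurable f).aemeasurable
      exact (by fun_prop : AEMeasurable (fun w => Complex.exp (Complex.I * (t * f w : ℝ))) μ)
        |>.aestronglyMeasurable
    · rw [mul_comm, Complex.norm_exp_ofReal_mul_I]
  have hd : MemLp (fun w => f w - g w) 2 μ := (Lp.memLp f).sub (Lp.memLp g)
  have hd1 : Integrable (fun w => f w - g w) μ := hd.integrable (by norm_num)
  rw [← integral_sub (hI f) (hI g)]
  calc ‖∫ w, (Complex.exp (Complex.I * (t * f w : ℝ))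
          - Complex.exp (Complex.I * (t * g w : ℝ))) ∂μ‖
      ≤ ∫ w, |t| * ‖f w - g w‖ ∂μ := by
        refine norm_integral_le_of_norm_le (hd1.norm.const_mul _)
          (Filter.Eventually.of_forall fun w => ?_)
        have h1 : Complex.exp (Complex.I * (t * f w : ℝ)) - Complex.exp (Complex.I * (t * g w : ℝ))
            = Complex.exp (Complex.I * (t * g w : ℝ)) *
              (Complex.exp (Complex.I * (t * (f w - g w) : ℝ)) - 1) := by
          rw [mul_sub, ← Complex.exp_add]
          push_cast
          ring_nf
        have h2 : ‖Complex.exp (Complex.I * (t * g w : ℝ))‖ = 1 := by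
          rw [mul_comm, Complex.norm_exp_ofReal_mul_I]
        rw [h1, norm_mul, h2, one_mul]
        refine Real.norm_exp_I_mul_ofReal_sub_one_le.trans ?_
        rw [norm_mul, Real.norm_eq_abs t]
    _ = |t| * ∫ w, ‖f w - g w‖ ∂μ := integral_const_mul _ _
    _ ≤ |t| * ‖f - g‖ := by
        gcongr
        rw [integral_norm_eq_lintegral_enorm hd1.1, ← eLpNorm_one_eq_lintegral_enorm, Lp.norm_def,
          eLpNorm_congr_ae (Lp.coeFn_sub f g)]
        exact ENNReal.toReal_mono hd.eLpNorm_ne_top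
          (eLpNorm_le_eLpNorm_of_exponent_le (by norm_num) hd.1)

lemma integral_sq_eq_norm_sq (f : Lp ℝ 2 μ) : ∫ w, f w ^ 2 ∂μ = ‖f‖ ^ 2 := by
  rw [← real_inner_self_eq_norm_sq, L2.inner_def]
  simp [sq]

/-- The square integrable functions with centred Gaussian law form a closed set. -/
lemma isClosed_setOf_map_eq_gaussianReal [IsProbabilityMeasure μ] :
    IsClosed {f : Lp ℝ 2 μ | μ.map f = gaussianReal 0 (‖f‖₊ ^ 2)} := by
  -- A law is determined by its characteristic function, so the set is an intersection of equations,
  -- one for each t, between continuous functions of f.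
  have hset : {f : Lp ℝ 2 μ | μ.map f = gaussianReal 0 (‖f‖₊ ^ 2)}
      = ⋂ t : ℝ, {f : Lp ℝ 2 μ | ∫ w, Complex.exp (Complex.I * (t * f w : ℝ)) ∂μ
          = Complex.exp (-((‖f‖ ^ 2 : ℝ) * t ^ 2 / 2))} := by
    ext f
    have hf : AEMeasurable f μ := (Lp.aestronglyMeasurable f).aemeasurable
    have h1 : ∀ t : ℝ, charFun (μ.map f) t = ∫ w, Complex.exp (Complex.I * (t * f w : ℝ)) ∂μ := by
      intro t
      rw [charFun_apply_real, integral_map hf (by fun_prop)]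
      congr 1; ext w; push_cast; ring_nf
    have h2 : ∀ t : ℝ, charFun (gaussianReal 0 (‖f‖₊ ^ 2)) t
        = Complex.exp (-((‖f‖ ^ 2 : ℝ) * t ^ 2 / 2)) := by
      intro t
      rw [charFun_gaussianReal]
      simp
    have : IsProbabilityMeasure (μ.map f) := Measure.isProbabilityMeasure_map hf
    simp only [Set.mem_iInter, Set.mem_ofPred_eq, ← h1, ← h2]
    exact ⟨fun h t => by rw [h], fun h => Measure.ext_of_charFun (funext h)⟩
  rw [hset]
  refine isClosed_iInter fun t => isClosed_eq ?_ (by fun_prop)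
  have : LipschitzWith ⟨|t|, abs_nonneg t⟩
      (fun f : Lp ℝ 2 μ => ∫ w, Complex.exp (Complex.I * (t * f w : ℝ)) ∂μ) :=
    LipschitzWith.of_dist_le_mul fun f g => by
      rw [dist_eq_norm, dist_eq_norm]
      exact norm_integral_cexp_sub_le t f g
  exact this.continuous

/-- Linear combinations in the closed span of a centred Gaussian process are Gaussian. -/
lemma map_eq_gaussianReal_of_mem_closure_span [IsProbabilityMeasure μ] {T : Type*}
    {e : T → Ω → ℝ} (he : IsGaussianProcess e μ) (he0 : ∀ t, ∫ w, e t w ∂μ = 0)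
    {E : T → Lp ℝ 2 μ} (hE : ∀ t, E t =ᵐ[μ] e t) {f : Lp ℝ 2 μ}
    (hf : f ∈ (Submodule.span ℝ (Set.range E)).topologicalClosure) :
    μ.map f = gaussianReal 0 (‖f‖₊ ^ 2) := by
  have hsub : (Submodule.span ℝ (Set.range E) : Set (Lp ℝ 2 μ))
      ⊆ {f : Lp ℝ 2 μ | μ.map f = gaussianReal 0 (‖f‖₊ ^ 2)} := by
    intro f hf
    obtain ⟨c, rfl⟩ := (Finsupp.mem_span_range_iff_exists_finsupp).1 hf
    have hae : (c.sum fun t a => a • E t : Lp ℝ 2 μ) =ᵐ[μ] fun w => ∑ t ∈ c.support, c t • e t w := by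
      have h1 := Lp.coeFn_fun_finsetSum c.support (fun t => c t • E t)
      have h2 : ∀ᵐ w ∂μ, ∀ t ∈ c.support, (c t • E t : Lp ℝ 2 μ) w = c t • e t w := by
        refine (Filter.eventually_all_finset _).2 fun t _ => ?_
        filter_upwards [Lp.coeFn_smul (c t) (E t), hE t] with w h3 h4
        rw [h3, Pi.smul_apply, h4]
      filter_upwards [h1, h2] with w h3 h4
      rw [Finsupp.sum, h3]
      exact Finset.sum_congr rfl h4
    have hG : HasGaussianLaw (c.sum fun t a => a • E t : Lp ℝ 2 μ) μ :=
      ((he.smul (fun t => c t)).hasGaussianLaw_fun_sum (I := c.support)).congr hae.symm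
    have h0 : ∫ w, (c.sum fun t a => a • E t : Lp ℝ 2 μ) w ∂μ = 0 := by
      have hi : ∀ t ∈ c.support, Integrable (fun w => c t • e t w) μ := fun t _ =>
        (he.hasGaussianLaw_eval t).integrable.smul (c t)
      rw [integral_congr_ae hae, integral_finsetSum _ hi]
      simp [integral_const_mul, he0]
    rw [Set.mem_ofPred_eq, hG.map_eq_gaussianReal, h0,
      variance_of_integral_eq_zero hG.aemeasurable h0, integral_sq_eq_norm_sq]
    congr 1
    ext
    simp
  exact closure_minimal hsub isClosed_setOf_map_eq_gaussianReal hf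

end GaussianSpace

/-! ### The state as a centred, stationary Gaussian process -/

section StateProcess

variable {Ω : Type*} [MeasurableSpace Ω] {μ : Measure Ω}

/-- Bridge between the pointwise convolution of the model and a series in L²: absolute convergence
in norm makes the L² sum agree almost everywhere with the pointwise one. -/
lemma ae_tsum_mul_eq_tsum_smul_toLp {z : ℤ → Ω → ℝ} (hz : ∀ k, MemLp (z k) 2 μ) {C : ℝ}
    (hC : ∀ k, ‖(hz k).toLp (z k)‖ ≤ C) {g : ℤ → ℝ} (hg : Summable g) (k : ℤ) :
    (fun w => ∑' l, g l * z (k - l) w)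
      =ᵐ[μ] (∑' l, g l • (hz (k - l)).toLp (z (k - l)) : Lp ℝ 2 μ) := by
  have hS := summable_norm_filter (X := fun k => (hz k).toLp (z k)) hg hC k
  have h1 : ∑' l, ‖g l • (hz (k - l)).toLp (z (k - l))‖ₑ ≠ ⊤ := by
    simp_rw [← ofReal_norm]
    exact hS.tsum_ofReal_ne_top
  have h2 : ∀ᵐ w ∂μ, ∀ l, (g l • (hz (k - l)).toLp (z (k - l)) : Lp ℝ 2 μ) w
      = g l * z (k - l) w := by
    refine ae_all_iff.2 fun l => ?_
    filter_upwards [Lp.coeFn_smul (g l) ((hz (k - l)).toLp (z (k - l))),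
      (hz (k - l)).coeFn_toLp] with w h3 h4
    rw [h3, Pi.smul_apply, h4, smul_eq_mul]
  filter_upwards [Lp.coeFn_tsum h1, h2] with w h3 h4
  rw [h3]
  exact tsum_congr fun l => (h4 l).symm

lemma norm_tsum_filter_le {H : Type*} [NormedAddCommGroup H] [InnerProductSpace ℝ H]
    {g : ℤ → ℝ} (hg : Summable g) {X : ℤ → H} {C : ℝ} (hX : ∀ k, ‖X k‖ ≤ C) (k : ℤ) :
    ‖∑' l, g l • X (k - l)‖ ≤ (∑' l, |g l|) * C := by
  refine (norm_tsum_le_tsum_norm (summable_norm_filter hg hX k)).trans ?_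
  rw [← tsum_mul_right]
  refine (summable_norm_filter hg hX k).tsum_le_tsum (fun l => ?_) (hg.abs.mul_right C)
  rw [norm_smul, Real.norm_eq_abs]
  gcongr
  exact hX _

variable {p : ℕ}

lemma IsAcyclic.wellFounded {V : Type*} [Finite V] {G : Digraph V} (hG : IsAcyclic G) :
    WellFounded (Relation.TransGen G.Adj) :=
  have : Std.Irrefl (Relation.TransGen G.Adj) := ⟨hG⟩
  Finite.wellFounded_of_trans_of_irrefl _

/-- Induction along the edges of a finite directed acyclic graph. -/
lemma IsAcyclic.induction {V : Type*} [Finite V] {G : Digraph V} (hG : IsAcyclic G)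
    {Q : V → Prop} (hQ : ∀ i, (∀ j, G.Adj j i → Q j) → Q i) (i : V) : Q i :=
  hG.wellFounded.induction i fun i ih => hQ i fun j hj => ih j (Relation.TransGen.single hj)

section Noise

variable {e : Fin p → ℤ → Ω → ℝ} {σ : ℝ → ℝ}

lemma IsNoise.memLp (he : IsNoise μ e σ) (i : Fin p) (k : ℤ) : MemLp (e i k) 2 μ :=
  (he.gaussian.hasGaussianLaw_eval (i, k)).memLp_two

lemma inner_toLp {f g : Ω → ℝ} (hf : MemLp f 2 μ) (hg : MemLp g 2 μ) :
    inner ℝ (hf.toLp f) (hg.toLp g) = ∫ w, f w * g w ∂μ := by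
  rw [L2.inner_def]
  refine integral_congr_ae ?_
  filter_upwards [hf.coeFn_toLp, hg.coeFn_toLp] with w h1 h2
  rw [h1, h2]
  simp [mul_comm]

lemma IsNoise.norm_toLp_eq (he : IsNoise μ e σ) (i : Fin p) (k : ℤ) :
    ‖(he.memLp i k).toLp (e i k)‖ = ‖(he.memLp i 0).toLp (e i 0)‖ := by
  rw [← sq_eq_sq₀ (norm_nonneg _) (norm_nonneg _), ← real_inner_self_eq_norm_sq,
    ← real_inner_self_eq_norm_sq, inner_toLp, inner_toLp]
  simpa using he.stationary i 0 k

lemma IsNoise.jointlyStationary (he : IsNoise μ e σ) (i j : Fin p) :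
    JointlyStationary (fun k => (he.memLp i k).toLp (e i k))
      (fun k => (he.memLp j k).toLp (e j k)) := by
  simp only [JointlyStationary, inner_toLp]
  rcases eq_or_ne i j with rfl | hij
  · exact ⟨he.stationary i, he.summable i⟩
  · simp [he.uncorrelated i j hij, summable_zero]

end Noise

variable {G : Digraph (Fin p)} {h : Fin p → Fin p → ℤ → ℝ} {σ : ℝ → ℝ}
  {e x : Fin p → ℤ → Ω → ℝ}

-- A summable filter maps bounded sequences in L² to bounded ones, and stationary noise has constant
-- norm. Boundedness in k must accompany square integrability in the induction, because the next
-- filter uses all times.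
open Classical in
lemma IsLDS.memLp_and_bounded (hx : IsLDS μ G h σ e x) (i : Fin p) :
    ∃ hm : ∀ k, MemLp (x i k) 2 μ, ∃ C, ∀ k, ‖(hm k).toLp (x i k)‖ ≤ C := by
  refine hx.acyclic.induction (Q := fun i => ∃ hm : ∀ k, MemLp (x i k) 2 μ, ∃ C,
    ∀ k, ‖(hm k).toLp (x i k)‖ ≤ C) (fun i ih => ?_) i
  -- Square integrability is known only for the parents of i, so the L² convolution is formed on
  -- edges and set to 0 elsewhere.
  let D : Fin p → ℤ → Lp ℝ 2 μ := fun j k =>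
    if hj : G.Adj j i then ∑' l, h i j l • ((ih j hj).choose (k - l)).toLp (x j (k - l)) else 0
  have hD : ∀ j, ∃ C, ∀ k, ‖D j k‖ ≤ C := fun j => by
    by_cases hj : G.Adj j i
    · obtain ⟨C, hC⟩ := (ih j hj).choose_spec
      refine ⟨(∑' l, |h i j l|) * C, fun k => ?_⟩
      simp only [D, hj, dite_true]
      exact norm_tsum_filter_le (X := fun k => ((ih j hj).choose k).toLp (x j k))
        (hx.filter_summable i j hj) hC k
    · exact ⟨0, fun k => by simp [D, hj]⟩
  have hae : ∀ k, x i k =ᵐ[μ]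
      (∑ j with G.Adj j i, D j k + (hx.noise.memLp i k).toLp (e i k) : Lp ℝ 2 μ) := by
    intro k
    have h1 : ∀ᵐ w ∂μ, ∀ j, G.Adj j i → (∑' l, h i j l * x j (k - l) w) = D j k w := by
      refine ae_all_iff.2 fun j => ?_
      by_cases hj : G.Adj j i
      · obtain ⟨C, hC⟩ := (ih j hj).choose_spec
        filter_upwards [ae_tsum_mul_eq_tsum_smul_toLp _ hC (hx.filter_summable i j hj) k] with w hw
        intro _
        simp only [D, hj, dite_true]
        exact hw
      · exact Filter.Eventually.of_forall fun w hj' => absurd hj' hj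
    filter_upwards [hx.evolution i k, h1, Lp.coeFn_add (∑ j with G.Adj j i, D j k)
      ((hx.noise.memLp i k).toLp (e i k)), Lp.coeFn_fun_finsetSum {j | G.Adj j i} (D · k),
      (hx.noise.memLp i k).coeFn_toLp] with w h2 h3 h4 h5 h6
    rw [h2, h4, Pi.add_apply, h5, h6]
    congr 1
    exact Finset.sum_congr rfl fun j hj => h3 j (Finset.mem_filter.1 hj).2
  have hm : ∀ k, MemLp (x i k) 2 μ := fun k => (memLp_congr_ae (hae k)).2 (Lp.memLp _)
  choose C hC using hD
  refine ⟨hm, ∑ j with G.Adj j i, C j + ‖(hx.noise.memLp i 0).toLp (e i 0)‖, fun k => ?_⟩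
  have h1 : (hm k).toLp (x i k)
      = ∑ j with G.Adj j i, D j k + (hx.noise.memLp i k).toLp (e i k) :=
    Lp.ext ((hm k).coeFn_toLp.trans (hae k))
  rw [h1]
  refine (norm_add_le _ _).trans ?_
  rw [hx.noise.norm_toLp_eq i k]
  gcongr
  exact (norm_sum_le _ _).trans (Finset.sum_le_sum fun j _ => hC j k)

lemma IsLDS.memLp (hx : IsLDS μ G h σ e x) (i : Fin p) (k : ℤ) : MemLp (x i k) 2 μ :=
  (hx.memLp_and_bounded i).choose k

lemma IsLDS.exists_norm_le (hx : IsLDS μ G h σ e x) (i : Fin p) :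
    ∃ C, ∀ k, ‖(hx.memLp i k).toLp (x i k)‖ ≤ C :=
  (hx.memLp_and_bounded i).choose_spec

open Classical in
/-- The evolution equation in the Hilbert space of square integrable random variables. -/
lemma IsLDS.toLp_eq (hx : IsLDS μ G h σ e x) (i : Fin p) (k : ℤ) :
    (hx.memLp i k).toLp (x i k)
      = ∑ j with G.Adj j i, ∑' l, h i j l • (hx.memLp j (k - l)).toLp (x j (k - l))
        + (hx.noise.memLp i k).toLp (e i k) := by
  refine Lp.ext ?_
  have h1 : ∀ᵐ w ∂μ, ∀ j, G.Adj j i → (∑' l, h i j l * x j (k - l) w)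
      = (∑' l, h i j l • (hx.memLp j (k - l)).toLp (x j (k - l)) : Lp ℝ 2 μ) w := by
    refine ae_all_iff.2 fun j => ?_
    by_cases hj : G.Adj j i
    · obtain ⟨C, hC⟩ := hx.exists_norm_le j
      filter_upwards [ae_tsum_mul_eq_tsum_smul_toLp _ hC (hx.filter_summable i j hj) k] with w hw
      exact fun _ => hw
    · exact Filter.Eventually.of_forall fun w hj' => absurd hj' hj
  filter_upwards [hx.evolution i k, h1, Lp.coeFn_add
    (∑ j with G.Adj j i, ∑' l, h i j l • (hx.memLp j (k - l)).toLp (x j (k - l)))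
    ((hx.noise.memLp i k).toLp (e i k)), Lp.coeFn_fun_finsetSum {j | G.Adj j i}
      (fun j => ∑' l, h i j l • (hx.memLp j (k - l)).toLp (x j (k - l))),
    (hx.noise.memLp i k).coeFn_toLp, (hx.memLp i k).coeFn_toLp] with w h2 h3 h4 h5 h6 h7
  rw [h7, h2, h4, Pi.add_apply, h5, h6]
  congr 1
  exact Finset.sum_congr rfl fun j hj => h3 j (Finset.mem_filter.1 hj).2

/-- Sums and filters preserve joint stationarity with a fixed partner, so it propagates along the
graph. Leaving the partner Z arbitrary allows two uses: first with Z a noise coordinate, then, after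
symmetry, with Z a state coordinate. -/
lemma IsLDS.jointlyStationary_of_noise (hx : IsLDS μ G h σ e x) {Z : ℤ → Lp ℝ 2 μ}
    (hZ : ∀ i, JointlyStationary (fun k => (hx.noise.memLp i k).toLp (e i k)) Z) (i : Fin p) :
    JointlyStationary (fun k => (hx.memLp i k).toLp (x i k)) Z := by
  classical
  refine hx.acyclic.induction (Q := fun i => JointlyStationary
    (fun k => (hx.memLp i k).toLp (x i k)) Z) (fun i ih => ?_) i
  simp_rw [hx.toLp_eq i]
  refine JointlyStationary.add (JointlyStationary.sum fun j hj => ?_) (hZ i)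
  have hj' := (Finset.mem_filter.1 hj).2
  obtain ⟨C, hC⟩ := hx.exists_norm_le j
  exact (ih j hj').filter (hx.filter_summable i j hj') hC

lemma IsLDS.jointlyStationary (hx : IsLDS μ G h σ e x) (i j : Fin p) :
    JointlyStationary (fun k => (hx.memLp i k).toLp (x i k))
      (fun k => (hx.memLp j k).toLp (x j k)) :=
  hx.jointlyStationary_of_noise (fun a => (hx.jointlyStationary_of_noise
    (fun b => hx.noise.jointlyStationary b a) j).symm) i

/-- By induction along the graph; closedness of the subspace absorbs the infinite convolution sums.
-/
lemma IsLDS.toLp_mem_closure_span (hx : IsLDS μ G h σ e x) (i : Fin p) (k : ℤ) :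
    (hx.memLp i k).toLp (x i k) ∈ (Submodule.span ℝ (Set.range fun t : Fin p × ℤ =>
      (hx.noise.memLp t.1 t.2).toLp (e t.1 t.2))).topologicalClosure := by
  classical
  set S := Submodule.span ℝ (Set.range fun t : Fin p × ℤ =>
      (hx.noise.memLp t.1 t.2).toLp (e t.1 t.2))
  refine hx.acyclic.induction (Q := fun i => ∀ k, (hx.memLp i k).toLp (x i k)
    ∈ S.topologicalClosure) (fun i ih k => ?_) i k
  rw [hx.toLp_eq]
  refine add_mem (sum_mem fun j hj => ?_)
    (S.le_topologicalClosure (Submodule.subset_span ⟨(i, k), rfl⟩))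
  have hj' := (Finset.mem_filter.1 hj).2
  obtain ⟨C, hC⟩ := hx.exists_norm_le j
  have hS := (summable_norm_filter (X := fun k => (hx.memLp j k).toLp (x j k))
    (hx.filter_summable i j hj') hC k).of_norm
  exact S.isClosed_topologicalClosure.mem_of_tendsto hS.hasSum
    (Filter.Eventually.of_forall fun s => sum_mem fun l _ =>
      S.topologicalClosure.smul_mem _ (ih j hj' (k - l)))

lemma IsLDS.map_sum_eq_gaussianReal [IsProbabilityMeasure μ] (hx : IsLDS μ G h σ e x)
    {ι : Type*} [Fintype ι] (τ : ι → Fin p × ℤ) (c : ι → ℝ) :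
    ∃ v, μ.map (fun w => ∑ a, c a * x (τ a).1 (τ a).2 w) = gaussianReal 0 v := by
  let f : Lp ℝ 2 μ := ∑ a, c a • (hx.memLp (τ a).1 (τ a).2).toLp (x (τ a).1 (τ a).2)
  have hf := map_eq_gaussianReal_of_mem_closure_span hx.noise.gaussian
    (fun t => hx.noise.mean_zero t.1 t.2) (fun t => (hx.noise.memLp t.1 t.2).coeFn_toLp) (f := f)
    (sum_mem fun a _ => Submodule.smul_mem _ _ (hx.toLp_mem_closure_span _ _))
  refine ⟨_, (Measure.map_congr ?_).trans hf⟩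
  have h1 : ∀ᵐ w ∂μ, ∀ a, (c a • (hx.memLp (τ a).1 (τ a).2).toLp (x (τ a).1 (τ a).2) : Lp ℝ 2 μ) w
      = c a * x (τ a).1 (τ a).2 w := by
    refine ae_all_iff.2 fun a => ?_
    filter_upwards [Lp.coeFn_smul (c a) ((hx.memLp (τ a).1 (τ a).2).toLp (x (τ a).1 (τ a).2)),
      (hx.memLp (τ a).1 (τ a).2).coeFn_toLp] with w h3 h4
    rw [h3, Pi.smul_apply, h4, smul_eq_mul]
  filter_upwards [h1, Lp.coeFn_fun_finsetSum Finset.univ (fun a =>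
    c a • (hx.memLp (τ a).1 (τ a).2).toLp (x (τ a).1 (τ a).2))] with w h2 h3
  rw [h3]
  exact Finset.sum_congr rfl fun a _ => (h2 a).symm

/-- Cramér–Wold: each linear functional of the samples is a finite linear combination, hence
Gaussian. -/
lemma IsLDS.hasGaussianLaw [IsProbabilityMeasure μ] (hx : IsLDS μ G h σ e x)
    {ι : Type*} [Fintype ι] (τ : ι → Fin p × ℤ) :
    HasGaussianLaw (fun w a => x (τ a).1 (τ a).2 w) μ := by
  classical
  have hmeas : Measurable fun w (a : ι) => x (τ a).1 (τ a).2 w :=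
    measurable_pi_lambda _ fun a => hx.measurable _ _
  refine ⟨isGaussian_of_isGaussian_map fun L => ?_⟩
  obtain ⟨v, hv⟩ := hx.map_sum_eq_gaussianReal τ (fun a => L (Pi.single a 1))
  rw [Measure.map_map (by fun_prop) hmeas]
  have : (L ∘ fun w (a : ι) => x (τ a).1 (τ a).2 w)
      = fun w => ∑ a, L (Pi.single a 1) * x (τ a).1 (τ a).2 w := by
    ext w
    refine (L.toLinearMap.pi_apply_eq_sum_univ _).trans (Finset.sum_congr rfl fun a _ => ?_)
    have h1 : (fun b => if a = b then (1 : ℝ) else 0) = Pi.single a 1 := by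
      ext b
      simp [Pi.single_apply, eq_comm]
    rw [smul_eq_mul, mul_comm, h1]
    rfl
  rw [this, hv]
  infer_instance

lemma IsLDS.integral_eq_zero [IsProbabilityMeasure μ] (hx : IsLDS μ G h σ e x) (i : Fin p)
    (k : ℤ) : ∫ w, x i k w ∂μ = 0 := by
  obtain ⟨v, hv⟩ := hx.map_sum_eq_gaussianReal (fun _ : Fin 1 => (i, k)) (fun _ => 1)
  simp only [Finset.univ_unique, Finset.sum_singleton, one_mul] at hv
  have h1 : ∫ z, z ∂(μ.map fun w => x i k w) = 0 := by rw [hv]; simp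
  rwa [integral_map (hx.measurable i k).aemeasurable (by fun_prop)] at h1

lemma IsLDS.integral_mul_eq (hx : IsLDS μ G h σ e x) (i j : Fin p) (k m : ℤ) :
    ∫ w, x i k w * x j m w ∂μ = autocorr μ x (k - m) i j := by
  have := (hx.jointlyStationary i j).1 (k - m) m
  simp only [inner_toLp, sub_add_cancel] at this
  exact this

lemma IsLDS.summable_autocorr (hx : IsLDS μ G h σ e x) (i j : Fin p) :
    Summable fun k => autocorr μ x k i j := by
  have := (hx.jointlyStationary i j).2
  simp only [inner_toLp] at this
  exact this

end StateProcess

/-! ### From the spectral density to the covariance of samples -/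

section SpectralBound

open scoped ComplexOrder

lemma integral_cexp_int (m : ℤ) :
    ∫ θ in (0 : ℝ)..2 * Real.pi, Complex.exp (Complex.I * θ * m)
      = if m = 0 then (2 * Real.pi : ℂ) else 0 := by
  split_ifs with hm
  · simp [hm]
  · have hc : Complex.I * m ≠ 0 := by simp [Complex.I_ne_zero, hm]
    have h1 : ∀ θ : ℝ, Complex.I * θ * m = Complex.I * m * θ := fun θ => by ring
    simp_rw [h1]
    rw [integral_exp_mul_complex hc]
    have h2 : Complex.exp (Complex.I * m * (2 * Real.pi : ℝ)) = 1 := by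
      rw [Complex.exp_eq_one_iff]
      exact ⟨m, by push_cast; ring⟩
    rw [h2]
    simp

lemma norm_cexp_neg_I (θ : ℝ) (k : ℤ) : ‖Complex.exp (-(Complex.I * θ * k))‖ = 1 := by
  rw [Complex.norm_exp]; simp

lemma continuous_tsum_mul_cexp {a : ℤ → ℂ} (ha : Summable fun k => ‖a k‖) :
    Continuous fun θ : ℝ => ∑' k, a k * Complex.exp (-(Complex.I * θ * k)) :=
  continuous_tsum (fun k => by fun_prop) ha fun k θ => by rw [norm_mul, norm_cexp_neg_I, mul_one]

/-- The Fourier coefficients of an absolutely convergent Fourier series. -/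
lemma integral_tsum_mul_cexp {a : ℤ → ℂ} (ha : Summable fun k => ‖a k‖) (m : ℤ) :
    ∫ θ in (0 : ℝ)..2 * Real.pi, (∑' k, a k * Complex.exp (-(Complex.I * θ * k)))
        * Complex.exp (Complex.I * θ * m) = 2 * Real.pi * a m := by
  let f : ℤ → C(ℝ, ℂ) := fun k =>
    ⟨fun θ => a k * Complex.exp (Complex.I * θ * (m - k : ℤ)), by fun_prop⟩
  have hf : Summable fun k => ‖(f k).restrict
      (⟨Set.uIcc (0 : ℝ) (2 * Real.pi), isCompact_uIcc⟩ : TopologicalSpace.Compacts ℝ)‖ := by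
    refine Summable.of_nonneg_of_le (fun k => norm_nonneg _) (fun k => ?_) ha
    refine (ContinuousMap.norm_le _ (norm_nonneg _)).2 fun θ => ?_
    simp only [f, ContinuousMap.restrict_apply, ContinuousMap.coe_mk]
    rw [norm_mul, Complex.norm_exp]
    simp
  have h1 := intervalIntegral.tsum_intervalIntegral_eq_of_summable_norm hf
  have h2 : ∀ k, ∫ θ in (0 : ℝ)..2 * Real.pi, f k θ = if k = m then 2 * Real.pi * a m else 0 := by
    intro k
    simp only [f, ContinuousMap.coe_mk]
    rw [intervalIntegral.integral_const_mul, integral_cexp_int]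
    by_cases hk : k = m
    · simp [hk, mul_comm]
    · simp [hk, sub_eq_zero, eq_comm (a := m)]
  simp_rw [h2, tsum_ite_eq] at h1
  rw [h1]
  congr 1
  ext θ
  rw [← tsum_mul_right]
  refine tsum_congr fun k => ?_
  simp only [f, ContinuousMap.coe_mk]
  rw [mul_assoc, ← Complex.exp_add]
  push_cast
  ring_nf

/-- A summable matrix sequence whose Fourier series is positive semidefinite is a positive
semidefinite kernel. -/
lemma sum_mul_mul_nonneg_of_fourier_nonneg {p : ℕ} {R : ℤ → Matrix (Fin p) (Fin p) ℝ}
    (hR : ∀ i j, Summable fun k => R k i j)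
    (hpos : ∀ θ ∈ Set.Icc 0 (2 * Real.pi), ∀ v : Fin p → ℂ,
      0 ≤ (star v ⬝ᵥ (Matrix.of fun i j =>
        ∑' k : ℤ, (R k i j : ℂ) * Complex.exp (-(Complex.I * θ * k))).mulVec v).re)
    {ι : Type*} [Fintype ι] (τ : ι → ℤ) (c : ι → Fin p → ℝ) :
    0 ≤ ∑ a, ∑ i, ∑ b, ∑ j, c a i * c b j * R (τ a - τ b) i j := by
  let F : Fin p → Fin p → ℝ → ℂ := fun i j θ =>
    ∑' k : ℤ, (R k i j : ℂ) * Complex.exp (-(Complex.I * θ * k))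
  have hRn : ∀ i j, Summable fun k => ‖(R k i j : ℂ)‖ := fun i j => by
    simpa using (hR i j).norm
  have hF : ∀ i j, Continuous (F i j) := fun i j => continuous_tsum_mul_cexp (hRn i j)
  -- Testing the symbol on this trigonometric polynomial and integrating over a period picks out the
  -- Fourier coefficients R(τ a - τ b), up to the factor 2π.
  let v : ℝ → Fin p → ℂ := fun θ i => ∑ a, (c a i : ℂ) * Complex.exp (-(Complex.I * θ * τ a))
  have hv : ∀ θ i, star (v θ i) = ∑ a, (c a i : ℂ) * Complex.exp (Complex.I * θ * τ a) := by
    intro θ i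
    simp only [v, star_sum, star_mul']
    refine Finset.sum_congr rfl fun a _ => ?_
    rw [← starRingEnd_apply, ← starRingEnd_apply, Complex.conj_ofReal, ← Complex.exp_conj]
    simp
  have hq : ∀ θ, star (v θ) ⬝ᵥ (Matrix.of fun i j => F i j θ).mulVec (v θ)
      = ∑ a, ∑ i, ∑ b, ∑ j, ((c a i * c b j : ℝ) : ℂ) *
        (F i j θ * Complex.exp (Complex.I * θ * (τ a - τ b : ℤ))) := by
    intro θ
    simp only [dotProduct, Matrix.mulVec, Pi.star_apply, hv, Matrix.of_apply]
    rw [Finset.sum_comm (s := (Finset.univ : Finset ι))]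
    refine Finset.sum_congr rfl fun i _ => ?_
    rw [Finset.sum_mul]
    refine Finset.sum_congr rfl fun a _ => ?_
    simp only [v, Finset.mul_sum]
    rw [Finset.sum_comm]
    refine Finset.sum_congr rfl fun b _ => Finset.sum_congr rfl fun j _ => ?_
    have : Complex.exp (Complex.I * θ * (τ a - τ b : ℤ))
        = Complex.exp (Complex.I * θ * τ a) * Complex.exp (-(Complex.I * θ * τ b)) := by
      rw [← Complex.exp_add]; push_cast; ring_nf
    rw [this]
    push_cast
    ring
  have hint : ∫ θ in (0 : ℝ)..2 * Real.pi,
        star (v θ) ⬝ᵥ (Matrix.of fun i j => F i j θ).mulVec (v θ)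
      = ((2 * Real.pi * ∑ a, ∑ i, ∑ b, ∑ j, c a i * c b j * R (τ a - τ b) i j : ℝ) : ℂ) := by
    have hcast : ((2 * Real.pi * ∑ a, ∑ i, ∑ b, ∑ j, c a i * c b j * R (τ a - τ b) i j : ℝ) : ℂ)
        = ∑ a, ∑ i, ∑ b, ∑ j,
          ((c a i * c b j : ℝ) : ℂ) * (2 * Real.pi * (R (τ a - τ b) i j : ℂ)) := by
      push_cast
      simp_rw [Finset.mul_sum]
      refine Finset.sum_congr rfl fun a _ => Finset.sum_congr rfl fun i _ =>
        Finset.sum_congr rfl fun b _ => Finset.sum_congr rfl fun j _ => ?_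
      ring
    rw [hcast]
    simp_rw [hq]
    have hc : ∀ a i b j, Continuous fun θ : ℝ => ((c a i * c b j : ℝ) : ℂ) *
        (F i j θ * Complex.exp (Complex.I * θ * (τ a - τ b : ℤ))) := fun a i b j =>
      continuous_const.mul ((hF i j).mul (by fun_prop))
    rw [intervalIntegral.integral_finsetSum fun a _ => Continuous.intervalIntegrable
      (continuous_finsetSum _ fun i _ => continuous_finsetSum _ fun b _ =>
        continuous_finsetSum _ fun j _ => hc a i b j) _ _]
    refine Finset.sum_congr rfl fun a _ => ?_
    rw [intervalIntegral.integral_finsetSum fun i _ => Continuous.intervalIntegrable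
      (continuous_finsetSum _ fun b _ => continuous_finsetSum _ fun j _ => hc a i b j) _ _]
    refine Finset.sum_congr rfl fun i _ => ?_
    rw [intervalIntegral.integral_finsetSum fun b _ => Continuous.intervalIntegrable
      (continuous_finsetSum _ fun j _ => hc a i b j) _ _]
    refine Finset.sum_congr rfl fun b _ => ?_
    rw [intervalIntegral.integral_finsetSum fun j _ => Continuous.intervalIntegrable
      (hc a i b j) _ _]
    refine Finset.sum_congr rfl fun j _ => ?_
    rw [intervalIntegral.integral_const_mul, integral_tsum_mul_cexp (hRn i j)]
  have hcont : Continuous fun θ => star (v θ) ⬝ᵥ (Matrix.of fun i j => F i j θ).mulVec (v θ) := by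
    simp_rw [hq]
    exact continuous_finsetSum _ fun a _ => continuous_finsetSum _ fun i _ =>
      continuous_finsetSum _ fun b _ => continuous_finsetSum _ fun j _ =>
        continuous_const.mul ((hF i j).mul (by fun_prop))
  have hre : 0 ≤ ∫ θ in (0 : ℝ)..2 * Real.pi,
      (star (v θ) ⬝ᵥ (Matrix.of fun i j => F i j θ).mulVec (v θ)).re :=
    intervalIntegral.integral_nonneg (by positivity) fun θ hθ => hpos θ hθ _
  have hre2 : ∫ θ in (0 : ℝ)..2 * Real.pi,
      (star (v θ) ⬝ᵥ (Matrix.of fun i j => F i j θ).mulVec (v θ)).re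
      = 2 * Real.pi * ∑ a, ∑ i, ∑ b, ∑ j, c a i * c b j * R (τ a - τ b) i j := by
    have h1 := Complex.reCLM.intervalIntegral_comp_comm
      (hcont.intervalIntegrable (μ := volume) 0 (2 * Real.pi))
    rw [hint] at h1
    simpa only [Complex.reCLM_apply, Complex.ofReal_re] using h1
  rw [hre2] at hre
  exact nonneg_of_mul_nonneg_right hre (by positivity)

lemma posSemidef_smul_one_sub_of_eigenvalues_le {p : ℕ} {A : Matrix (Fin p) (Fin p) ℂ}
    (hA : A.IsHermitian) {M : ℝ} (hM : ∀ i, hA.eigenvalues i ≤ M) :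
    ((M : ℂ) • (1 : Matrix (Fin p) (Fin p) ℂ) - A).PosSemidef := by
  have hH : ((M : ℂ) • (1 : Matrix (Fin p) (Fin p) ℂ) - A).IsHermitian := by
    refine Matrix.IsHermitian.sub ?_ hA
    rw [Matrix.IsHermitian, Matrix.conjTranspose_smul, Matrix.conjTranspose_one]
    simp
  rw [hH.posSemidef_iff_eigenvalues_nonneg]
  intro i
  have h1 := hH.eigenvalues_mem_spectrum_real i
  have h2 : (M : ℂ) • (1 : Matrix (Fin p) (Fin p) ℂ) - A
      = algebraMap ℝ (Matrix (Fin p) (Fin p) ℂ) M - A := by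
    rw [Algebra.algebraMap_eq_smul_one]
    congr 1
  have h3 : M - hH.eigenvalues i ∈ spectrum ℝ A := by
    generalize hH.eigenvalues i = l at h1
    rw [h2, ← spectrum.singleton_sub_eq] at h1
    obtain ⟨a, ha, b, hb, rfl⟩ := Set.mem_sub.1 h1
    rw [Set.mem_singleton_iff.1 ha]
    simpa using hb
  rw [hA.spectrum_real_eq_range_eigenvalues] at h3
  obtain ⟨j, hj⟩ := h3
  have := hM j
  simp only [Pi.zero_apply]
  linarith

variable {Ω : Type*} [MeasurableSpace Ω] {μ : Measure Ω} {p : ℕ}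
  {G : Digraph (Fin p)} {h : Fin p → Fin p → ℤ → ℝ} {σ : ℝ → ℝ}
  {e x : Fin p → ℤ → Ω → ℝ}

/-- The upper bound on the power spectral density bounds the covariance of samples at distinct
times. -/
lemma IsLDS.integral_sq_sum_le (hx : IsLDS μ G h σ e x) {M : ℝ} (hM : PSDBounded μ x M)
    {ι : Type*} [Fintype ι] {τ : ι → ℤ} (hτ : Function.Injective τ) (c : ι × Fin p → ℝ) :
    ∫ w, (∑ a, c a * x a.2 (τ a.1) w) ^ 2 ∂μ ≤ M * ∑ a, c a ^ 2 := by
  classical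
  have h1 : ∫ w, (∑ a, c a * x a.2 (τ a.1) w) ^ 2 ∂μ
      = ∑ a, ∑ i, ∑ b, ∑ j, c (a, i) * c (b, j) * autocorr μ x (τ a - τ b) i j := by
    have hI : ∀ a b : ι × Fin p, Integrable
        (fun w => c a * x a.2 (τ a.1) w * (c b * x b.2 (τ b.1) w)) μ := fun a b =>
      ((hx.memLp _ _).const_mul _).integrable_mul ((hx.memLp _ _).const_mul _)
    simp_rw [sq, Finset.sum_mul_sum]
    rw [integral_finsetSum _ fun a _ => integrable_finsetSum _ fun b _ => hI a b,
      Fintype.sum_prod_type]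
    refine Finset.sum_congr rfl fun a _ => Finset.sum_congr rfl fun i _ => ?_
    rw [integral_finsetSum _ fun b _ => hI _ b, Fintype.sum_prod_type]
    refine Finset.sum_congr rfl fun b _ => Finset.sum_congr rfl fun j _ => ?_
    rw [← hx.integral_mul_eq, ← integral_const_mul]
    congr 1
    ext w
    ring
  -- The kernel M δ₀ I - R_x has Fourier series M I - Φ_x, which is positive semidefinite.
  let R : ℤ → Matrix (Fin p) (Fin p) ℝ := fun k =>
    (if k = 0 then M • (1 : Matrix (Fin p) (Fin p) ℝ) else 0) - autocorr μ x k
  have hRapp : ∀ k i j, R k i j = (if k = 0 then M * (1 : Matrix (Fin p) (Fin p) ℝ) i j else 0)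
      - autocorr μ x k i j := fun k i j => by
    simp only [R, Matrix.sub_apply]
    split_ifs <;> simp
  have hδ : ∀ i j, Summable fun k : ℤ =>
      if k = 0 then M * (1 : Matrix (Fin p) (Fin p) ℝ) i j else 0 := fun i j =>
    (hasSum_ite_eq 0 _).summable
  have hR : ∀ i j, Summable fun k => R k i j := fun i j => by
    simp_rw [hRapp]
    exact (hδ i j).sub (hx.summable_autocorr i j)
  have hpsd : ∀ θ : ℝ, (Matrix.of fun i j =>
      ∑' k : ℤ, (R k i j : ℂ) * Complex.exp (-(Complex.I * θ * k)))
        = (M : ℂ) • (1 : Matrix (Fin p) (Fin p) ℂ) - psd μ x θ := by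
    intro θ
    ext i j
    simp only [Matrix.of_apply, Matrix.sub_apply, psd, hRapp]
    have h2 : HasSum (fun k : ℤ => ((if k = 0 then M * (1 : Matrix (Fin p) (Fin p) ℝ) i j else 0 : ℝ)
        : ℂ) * Complex.exp (-(Complex.I * θ * k)))
        (((M : ℂ) • (1 : Matrix (Fin p) (Fin p) ℂ)) i j) := by
      have := hasSum_ite_eq (0 : ℤ) (((M : ℂ) • (1 : Matrix (Fin p) (Fin p) ℂ)) i j)
      convert! this using 2 with k
      by_cases hk : k = 0
      · simp only [hk, if_true, Matrix.smul_apply, Matrix.one_apply]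
        split_ifs <;> simp
      · simp [hk]
    have h3 : Summable fun k : ℤ =>
        (autocorr μ x k i j : ℂ) * Complex.exp (-(Complex.I * θ * k)) := by
      refine Summable.of_norm ?_
      simp_rw [norm_mul, norm_cexp_neg_I, mul_one, Complex.norm_real]
      exact (hx.summable_autocorr i j).norm
    rw [← h2.tsum_eq, ← h2.summable.tsum_sub h3]
    refine tsum_congr fun k => ?_
    push_cast
    ring
  have hpos := sum_mul_mul_nonneg_of_fourier_nonneg hR (fun θ hθ v => by
    obtain ⟨hΦ, hl⟩ := hM.2 θ hθ
    rw [hpsd]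
    exact (posSemidef_smul_one_sub_of_eigenvalues_le hΦ fun i => (hl i).2).re_dotProduct_nonneg v)
    τ (fun a i => c (a, i))
  have h4 : ∑ a, ∑ i, ∑ b, ∑ j, c (a, i) * c (b, j) *
      (if τ a - τ b = 0 then M * (1 : Matrix (Fin p) (Fin p) ℝ) i j else 0)
      = M * ∑ a, c a ^ 2 := by
    rw [Fintype.sum_prod_type, Finset.mul_sum]
    refine Finset.sum_congr rfl fun a _ => ?_
    rw [Finset.mul_sum]
    refine Finset.sum_congr rfl fun i _ => ?_
    rw [Finset.sum_eq_single a, Finset.sum_eq_single i]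
    · simp; ring
    · intro j _ hj
      simp [hj.symm]
    · simp
    -- Distinct times are essential here: the δ₀ part contributes only on the diagonal a = b.
    · intro b _ hb
      have : τ a - τ b ≠ 0 := fun h => hb (hτ (sub_eq_zero.1 h)).symm
      simp [this]
    · simp
  have h5 : ∑ a, ∑ i, ∑ b, ∑ j, c (a, i) * c (b, j) * R (τ a - τ b) i j
      = M * ∑ a, c a ^ 2 - ∫ w, (∑ a, c a * x a.2 (τ a.1) w) ^ 2 ∂μ := by
    rw [h1, ← h4]
    simp_rw [hRapp, mul_sub, Finset.sum_sub_distrib]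
  rw [h5] at hpos
  linarith

end SpectralBound

/-! ### The two sampling schemes -/

section Sampling

variable {Ω : Type*} [MeasurableSpace Ω] {μ : Measure Ω} {p n N : ℕ}
  {G : Digraph (Fin p)} {h : Fin p → Fin p → ℤ → ℝ} {σ : ℝ → ℝ} {e x : Fin p → ℤ → Ω → ℝ}

/-- Writing the entries through products of two samples reduces their expectations to
autocorrelations and makes measurability evident. -/
lemma outer_dft_apply (y : Fin N → Fin p → ℝ) (θ : ℝ) (i j : Fin p) :
    outer (dft y θ) i j = ∑ k : Fin N, ∑ l : Fin N,
      (((1 / Real.sqrt N : ℝ) : ℂ) * Complex.exp (-(Complex.I * θ * (k : ℕ)))) *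
        star (((1 / Real.sqrt N : ℝ) : ℂ) * Complex.exp (-(Complex.I * θ * (l : ℕ)))) *
        ((y k i * y l j : ℝ) : ℂ) := by
  rw [outer, Matrix.vecMulVec_apply, Pi.star_apply, dft, dft, Finset.mul_sum, Finset.mul_sum,
    star_sum, Finset.sum_mul_sum]
  refine Finset.sum_congr rfl fun k _ => Finset.sum_congr rfl fun l _ => ?_
  have h1 : ∀ r : ℝ, star (r : ℂ) = r := Complex.conj_ofReal
  simp only [star_mul', h1]
  push_cast
  ring

lemma measurable_outer_dft (θ : ℝ) (i j : Fin p) :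
    Measurable fun y : Fin N → Fin p → ℝ => outer (dft y θ) i j := by
  simp_rw [outer_dft_apply]
  fun_prop

/-- The covariance of the transform of a window does not depend on its position. -/
lemma IsLDS.dftCov_window (hx : IsLDS μ G h σ e x) (θ : ℝ) (t : ℤ) :
    dftCov μ (window x N t) θ = dftCov μ (window x N 0) θ := by
  have key : ∀ (t : ℤ) (i j : Fin p), dftCov μ (window x N t) θ i j
      = ∑ k : Fin N, ∑ l : Fin N,
      (((1 / Real.sqrt N : ℝ) : ℂ) * Complex.exp (-(Complex.I * θ * (k : ℕ)))) *
        star (((1 / Real.sqrt N : ℝ) : ℂ) * Complex.exp (-(Complex.I * θ * (l : ℕ)))) *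
        (autocorr μ x ((k : ℕ) - (l : ℕ)) i j : ℂ) := by
    intro t i j
    have hI : ∀ k l : Fin N,
        Integrable (fun w => ((x i (t + (k : ℕ)) w * x j (t + (l : ℕ)) w : ℝ) : ℂ)) μ :=
      fun k l => ((hx.memLp i _).integrable_mul (hx.memLp j _)).ofReal
    simp only [dftCov, Matrix.of_apply, outer_dft_apply, window]
    rw [integral_finsetSum _ fun k _ => integrable_finsetSum _ fun l _ => (hI k l).const_mul _]
    refine Finset.sum_congr rfl fun k _ => ?_
    rw [integral_finsetSum _ fun l _ => (hI k l).const_mul _]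
    refine Finset.sum_congr rfl fun l _ => ?_
    rw [integral_const_mul, integral_complex_ofReal, hx.integral_mul_eq,
      add_sub_add_left_eq_sub]
  ext i j
  rw [key, key]

theorem IsLDS.measureReal_segments_ge_le [IsProbabilityMeasure μ] (hx : IsLDS μ G h σ e x) (hn : 0 < n) (hN : 0 < N)
    {M : ℝ} (hM : PSDBounded μ x M) (θ : ℝ) {ε : ℝ} (hε : 0 ≤ ε) (hεM : ε ≤ 12 * M) (s : Fin n) :
    μ.real {w | ε ≤ ‖spectrogram (fun r => segments n N x r w) θ
        - dftCov μ (segments n N x s) θ‖}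
      ≤ Real.exp (-(ε ^ 2 * n / (128 * M ^ 2)) + 6 * p) := by
  -- The segments do not overlap: rN + k determines (r, k). The covariance bound therefore holds for
  -- all nN samples at once, despite the dependence between segments.
  let τ : Fin n × Fin N → ℤ := fun a => ((a.1 : ℕ) * N : ℕ) + (a.2 : ℕ)
  have hτ : Function.Injective τ := by
    rintro ⟨r, k⟩ ⟨r', k'⟩ h
    have h1 : (r : ℕ) * N + k = (r' : ℕ) * N + k' := by
      have h' : (((r : ℕ) * N : ℕ) : ℤ) + (k : ℕ) = ((r' : ℕ) * N : ℕ) + (k' : ℕ) := h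
      exact_mod_cast h'
    have h2 : finProdFinEquiv (r, k) = finProdFinEquiv (r', k') := by
      ext
      simp only [finProdFinEquiv_apply_val]
      linarith
    exact finProdFinEquiv.injective h2
  refine measureReal_spectrogram_sub_ge_le hn hN (y := segments n N x) ?_ ?_ hM.1 ?_ ?_ hε hεM
  · exact hx.hasGaussianLaw fun t : Fin n × Fin N × Fin p => (t.2.2, τ (t.1, t.2.1))
  · exact fun r k i => hx.integral_eq_zero i _
  · intro c
    have h1 := hx.integral_sq_sum_le hM hτ fun a => c (Equiv.prodAssoc _ _ _ a)
    rw [(Equiv.prodAssoc (Fin n) (Fin N) (Fin p)).sum_comp fun t => c t ^ 2] at h1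
    refine le_trans (le_of_eq ?_) h1
    congr 1
    ext w
    congr 1
    exact ((Equiv.prodAssoc (Fin n) (Fin N) (Fin p)).sum_comp
      fun t => c t * segments n N x t.1 w t.2.1 t.2.2).symm
  · intro r
    rw [segments, segments, hx.dftCov_window, ← hx.dftCov_window θ _]

theorem IsLDS.measureReal_restartRecord_ge_le [IsProbabilityMeasure μ]
    {Ω' : Type*} [MeasurableSpace Ω'] {P : Measure Ω'} (hx : IsLDS μ G h σ e x) (hn : 0 < n) (hN : 0 < N)
    {M : ℝ} (hM : PSDBounded μ x M) (θ : ℝ) {ε : ℝ} (hε : 0 ≤ ε) (hεM : ε ≤ 12 * M)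
    {y : Fin n → Ω' → Fin N → Fin p → ℝ} (hy : IsRestartRecord μ x P y) (s : Fin n) :
    P.real {w | ε ≤ ‖spectrogram (fun r => y r w) θ - dftCov P (y s) θ‖}
      ≤ Real.exp (-(ε ^ 2 * n / (128 * M ^ 2)) + 6 * p) := by
  obtain ⟨hind, hid⟩ := hy
  have hP := hind.isProbabilityMeasure
  have hwin : HasGaussianLaw (window x N 0) μ := by
    let L : (Fin N × Fin p → ℝ) →L[ℝ] (Fin N → Fin p → ℝ) := LinearMap.toContinuousLinearMap
      (LinearMap.pi fun k => LinearMap.pi fun i => LinearMap.proj (k, i))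
    exact (hx.hasGaussianLaw fun t : Fin N × Fin p => (t.2, (0 : ℤ) + (t.1 : ℕ))).map_fun L
  have hyG : ∀ r, HasGaussianLaw (y r) P := fun r => by
    refine ⟨?_⟩
    rw [(hid r).map_eq]
    exact hwin.isGaussian_map
  have hmem : ∀ r k i, MemLp (fun w => y r w k i) 2 P := fun r k i =>
    ((hyG r).map_fun ((ContinuousLinearMap.proj (R := ℝ) (φ := fun _ : Fin p => ℝ) i).comp
      (ContinuousLinearMap.proj (R := ℝ) (φ := fun _ : Fin N => Fin p → ℝ) k))).memLp_two
  have h0 : ∀ r k i, ∫ w, y r w k i ∂P = 0 := fun r k i => by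
    have h1 := (hid r).comp (u := fun z => z k i) (by fun_prop)
    exact h1.integral_eq.trans (hx.integral_eq_zero i _)
  refine measureReal_spectrogram_sub_ge_le hn hN (y := y) ?_ h0 hM.1 ?_ ?_ hε hεM
  · let L : (Fin n → Fin N → Fin p → ℝ) →L[ℝ] (Fin n × Fin N × Fin p → ℝ) :=
      LinearMap.toContinuousLinearMap
        { toFun z t := z t.1 t.2.1 t.2.2
          map_add' _ _ := rfl
          map_smul' _ _ := rfl }
    exact (hind.hasGaussianLaw hyG).map_fun L
  · intro c
    let Z : Fin n → Ω' → ℝ := fun r w => ∑ t : Fin N × Fin p, c (r, t) * y r w t.1 t.2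
    have hZmem : ∀ r, MemLp (Z r) 2 P := fun r =>
      memLp_finsetSum _ fun t _ => (hmem r t.1 t.2).const_mul _
    have hZ0 : ∀ r, ∫ w, Z r w ∂P = 0 := fun r => by
      simp only [Z]
      rw [integral_finsetSum _ fun t _ => ((hmem _ _ _).integrable (by norm_num)).const_mul _]
      simp [integral_const_mul, h0]
    have hZind : iIndepFun Z P := hind.comp
      (fun r (z : Fin N → Fin p → ℝ) => ∑ t : Fin N × Fin p, c (r, t) * z t.1 t.2)
      fun r => by fun_prop
    have hZV : ∀ r, ∫ w, Z r w ^ 2 ∂P ≤ M * ∑ t, c (r, t) ^ 2 := fun r => by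
      have h1 := ((hid r).comp (u := fun z => (∑ t : Fin N × Fin p, c (r, t) * z t.1 t.2) ^ 2)
        (by fun_prop)).integral_eq
      have hinj : Function.Injective fun k : Fin N => (0 : ℤ) + (k : ℕ) := fun a b h => by
        ext
        simpa using h
      exact h1.trans_le (hx.integral_sq_sum_le hM hinj fun t => c (r, t))
    -- The Z r are independent and centred, so their second moments add and the bound for a single
    -- trajectory extends to all n.
    have hvar : ∫ w, (∑ r, Z r w) ^ 2 ∂P = ∑ r, ∫ w, Z r w ^ 2 ∂P := by
      have h1 := IndepFun.variance_sum (μ := P) (X := Z) (s := Finset.univ)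
        (fun r _ => hZmem r) fun r _ r' _ hrr => hZind.indepFun hrr
      have h2 : ∫ w, (∑ r, Z r) w ∂P = 0 := by
        simp only [Finset.sum_apply]
        rw [integral_finsetSum _ fun r _ => (hZmem r).integrable (by norm_num)]
        simp [hZ0]
      rw [variance_of_integral_eq_zero
        (Finset.aemeasurable_sum _ fun r _ => (hZmem r).1.aemeasurable) h2] at h1
      simp only [Finset.sum_apply] at h1
      rw [h1]
      exact Finset.sum_congr rfl fun r _ =>
        variance_of_integral_eq_zero (hZmem r).1.aemeasurable (hZ0 r)
    simp_rw [Fintype.sum_prod_type (α₁ := Fin n)]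
    calc ∫ w, (∑ r, Z r w) ^ 2 ∂P = ∑ r, ∫ w, Z r w ^ 2 ∂P := hvar
      _ ≤ ∑ r, M * ∑ t, c (r, t) ^ 2 := Finset.sum_le_sum fun r _ => hZV r
      _ = _ := by rw [Finset.mul_sum]
  · intro r
    have key : ∀ r, dftCov P (y r) θ = dftCov μ (window x N 0) θ := fun r => by
      ext i j
      exact ((hid r).comp (measurable_outer_dft θ i j)).integral_eq
    rw [key, key]

end Sampling

end DDAG

end

theorem theorem4p2 {Ω Ω' : Type*} [MeasurableSpace Ω] [MeasurableSpace Ω']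
    (μ : Measure Ω) [IsProbabilityMeasure μ] (P : Measure Ω') [IsProbabilityMeasure P]
    {p n N : ℕ} (hn : 0 < n) (hN : 0 < N)
    (G : Digraph (Fin p)) (h : Fin p → Fin p → ℤ → ℝ) (σ : ℝ → ℝ)
    (e x : Fin p → ℤ → Ω → ℝ) (hx : DDAG.IsLDS μ G h σ e x)
    (M : ℝ) (hM : DDAG.PSDBounded μ x M)
    (θ : ℝ) (hθ : θ ∈ Set.Icc 0 (2 * Real.pi))
    (ε : ℝ) (hε : 0 ≤ ε) (hεM : ε ≤ 12 * M) :
    -- restart and record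
    (∀ y : Fin n → Ω' → Fin N → Fin p → ℝ, DDAG.IsRestartRecord μ x P y → ∀ s : Fin n,
      P.real {w | ε ≤ ‖DDAG.spectrogram (fun r => y r w) θ - DDAG.dftCov P (y s) θ‖}
        ≤ Real.exp (-(ε ^ 2 * n / (128 * M ^ 2)) + 6 * p)) ∧
    -- continuous sampling
    (∀ s : Fin n,
      μ.real {w | ε ≤ ‖DDAG.spectrogram (fun r => DDAG.segments n N x r w) θ
          - DDAG.dftCov μ (DDAG.segments n N x s) θ‖}
        ≤ Real.exp (-(ε ^ 2 * n / (128 * M ^ 2)) + 6 * p)) :=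
  ⟨fun _ hy s => hx.measureReal_restartRecord_ge_le hn hN hM θ hε hεM hy s,
    fun s => hx.measureReal_segments_ge_le hn hN hM θ hε hεM s⟩
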